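/- **Model.** Let $Y,Y^*\in\{0,1\}$ be a response and its error-prone surrogate and let $Z$ be a random vector in $\mathbb R^p$. Let $g$ be a link function on $(0,1)$, strictly monotone and differentiable, and let $g_0(z;\nu),g_1(z;\nu)$, $\nu\in\mathbb R^q$, be given real functions, measurable in $z$. For $\theta=(\beta_0^*,\beta^{T},\nu^{T})^{T}\in\mathbb R^{d}$, $d=1+p+q$, let $g(\mu(z))=\beta^*_0+z^{T}\beta$ with $\mu(z)\in(0,1)$, $\operatorname{logit}\gamma_{01}(z)=g_0(z;\nu)$, $\operatorname{logit}\gamma_{10}(z)=g_1(z;\nu)$ and $\mu^*(z)=\gamma_{01}(z)+\{1-\gamma_{01}(z)-\gamma_{10}(z)\}\mu(z)$. Put $a_0(1,z)=\gamma_{01}(z)=1-a_0(0,z)$, $a_1(0,z)=\gamma_{10}(z)=1-a_1(1,z)$, and $$f(y,y^*|z)=\{\mu(z)a_1(y^*,z)\}^{y}\{(1-\mu(z))a_0(y^*,z)\}^{1-y},\qquad f(y^*|z)=\mu^*(z)^{y^*}\{1-\mu^*(z)\}^{1-y^*}.$$ Suppose that for a true value $\theta_0=(\beta^*_{00},\beta_{10},\dots,\beta_{p0},\nu_0^{T})^{T}$,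 $P(Y=1|Z)=\mu(Z)$, $P(Y^*=1|Y=0,Z)=\gamma_{01}(Z)$ and $P(Y^*=0|Y=1,Z)=\gamma_{10}(Z)$ almost surely. Let $(Y_i,Y_i^*,Z_i)$ be i.i.d. copies of $(Y,Y^*,Z)$. For each $n$ the main study sample $\mathcal M$ consists of the first $n$ subjects, for which $(Y_i^*,Z_i)$ is observed; the validation sample $\mathcal V\subseteq\mathcal M$ is a random subset of non-random size $n_v$, selected independently of the data of the $n$ subjects, for which $Y_i$ is observed as well; and $n_v/n\to\delta\in(0,1]$. **Regularity conditions.** There is an open set $N\ni\theta_0$ such that, for almost every $z$, $\beta_0^*+z^{T}\beta$ lies in $g((0,1))$ for all $\theta\in N$; and, both for $L=\log f(y,y^*|z)$ and for $L=\log f(y^*|z)$: (i) for almost every $z$ and all $y,y^*$, $L$ is three times continuously differentiable in $\theta$ on $N$; (ii) at $\theta_0$ the first partial derivatives of $L$ are square integrable and the second partial derivatives are integrable under the law of $(Y,Y^*,Z)$; (iii) almost surely all third partial derivatives of $L$ are bounded in absolute value, uniformly over $\theta\in N$, by a function of $(Y,Y^*,Z)$ with finite expectation. Moreover $\delta I_1^*(\theta_0)+(1-\delta)I_2^*(\theta_0)$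 is positive definite, where $I_1^*(\theta_0)$ and $I_2^*(\theta_0)$ are the second moment matrices of the scores $\partial_\theta\log f(Y,Y^*|Z)$ and $\partial_\theta\log f(Y^*|Z)$ at $\theta_0$. **Penalty.** For $\lambda\ge0$ let $\rho_\lambda:[0,\infty)\to[0,\infty)$ be continuous with $\rho_\lambda(0)=0$. Let $\lambda_n\ge0$, and suppose that there are constants $C>0$ and $D$ such that for every $n$, $\rho_{\lambda_n}$ is twice differentiable on $(C\lambda_n,\infty)$ with $|\rho''_{\lambda_n}(\xi_1)-\rho''_{\lambda_n}(\xi_2)|\le D|\xi_1-\xi_2|$ for all $\xi_1,\xi_2>C\lambda_n$. Put $$a_n=\max\{|\rho'_{\lambda_n}(|\beta_{j0}|)|:\beta_{j0}\neq0\},\qquad b_n=\max\{|\rho''_{\lambda_n}(|\beta_{j0}|)|:\beta_{j0}\ne0\}$$ (both $0$ if all $\beta_{j0}$ vanish), and let $$Q^*_{\mathrm{ML}}(\theta)=\sum_{i\in\mathcal V}\log f(Y_i,Y_i^*|Z_i)+\sum_{i\in\mathcal M\setminus\mathcal V}\log f(Y_i^*|Z_i)-n\sum_{j=1}^p\rho_{\lambda_n}(|\beta_j|).$$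 **Theorem.** If $\lambda_n\to0$, $a_n\to 0$ and $b_n\to0$ as $n\to\infty$, then there are random vectors $\widehat\theta_{\mathrm{ML}}=\widehat\theta_{\mathrm{ML},n}$ such that, with probability tending to one, $\widehat\theta_{\mathrm{ML}}$ is a local maximizer of $Q^*_{\mathrm{ML}}$, and $$\|\widehat\theta_{\mathrm{ML}}-\theta_0\|_2=O_p(n^{-1/2}+a_n).$$ -/

import Mathlib

open MeasureTheory ProbabilityTheory Filter Topology

/-- The parameter space `ℝ^d`, `d = 1 + p + q`, with the Euclidean norm.  A parameter `θ` consists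
of an intercept, the `p` regression coefficients and the `q` parameters `ν` of the
misclassification model. -/
abbrev Param (p q : ℕ) : Type := EuclideanSpace ℝ (Unit ⊕ Fin p ⊕ Fin q)

/-- The intercept of the response model. -/
def Param.intercept {p q : ℕ} (θ : Param p q) : ℝ := θ (Sum.inl ())

/-- The regression coefficients of the response model. -/
def Param.beta {p q : ℕ} (θ : Param p q) (j : Fin p) : ℝ := θ (Sum.inr (Sum.inl j))

/-- The parameters of the misclassification model. -/
def Param.nu {p q : ℕ} (θ : Param p q) (k : Fin q) : ℝ := θ (Sum.inr (Sum.inr k))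

/-- A full observation `(Y, Y*, Z)`: true response, surrogate response, covariates.
The value `1` of a binary response is `true`, the value `0` is `false`. -/
abbrev Obs (p : ℕ) : Type := Bool × Bool × (Fin p → ℝ)

/-- The parametric model: a generalized linear model for the binary response with a link function
`g` on `(0,1)`, and misclassification probabilities whose logits are the given functions
`g₀(z; ν)` and `g₁(z; ν)`. -/
structure MisclassModel (p q : ℕ) where
  /-- the link function (only its values on `(0,1)` are used) -/
  link : ℝ → ℝ
  link_monotone : StrictMonoOn link (Set.Ioo 0 1) ∨ StrictAntiOn link (Set.Ioo 0 1)
  link_differentiable : DifferentiableOn ℝ link (Set.Ioo 0 1)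
  /-- `logit γ₀₁(z) = g₀ z ν` -/
  g₀ : (Fin p → ℝ) → (Fin q → ℝ) → ℝ
  /-- `logit γ₁₀(z) = g₁ z ν` -/
  g₁ : (Fin p → ℝ) → (Fin q → ℝ) → ℝ
  measurable_g₀ : ∀ ν, Measurable fun z => g₀ z ν
  measurable_g₁ : ∀ ν, Measurable fun z => g₁ z ν

namespace MisclassModel

variable {p q : ℕ} (M : MisclassModel p q)

/-- The linear predictor `β₀* + zᵀ β`. -/
def linPred (θ : Param p q) (z : Fin p → ℝ) : ℝ := θ.intercept + ∑ j, z j * θ.beta j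

/-- `μ(z)`, the solution in `(0,1)` of `g(μ(z)) = β₀* + zᵀ β` whenever there is one. -/
noncomputable def mu (θ : Param p q) (z : Fin p → ℝ) : ℝ :=
  Function.invFunOn M.link (Set.Ioo 0 1) (linPred θ z)

/-- `γ₀₁(z) = P(Y* = 1 | Y = 0, Z = z)`, the number in `(0,1)` with logit `g₀(z; ν)`. -/
noncomputable def gamma01 (θ : Param p q) (z : Fin p → ℝ) : ℝ := Real.sigmoid (M.g₀ z θ.nu)

/-- `γ₁₀(z) = P(Y* = 0 | Y = 1, Z = z)`, the number in `(0,1)` with logit `g₁(z; ν)`. -/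
noncomputable def gamma10 (θ : Param p q) (z : Fin p → ℝ) : ℝ := Real.sigmoid (M.g₁ z θ.nu)

/-- `μ*(z) = γ₀₁(z) + {1 - γ₀₁(z) - γ₁₀(z)} μ(z)`. -/
noncomputable def muStar (θ : Param p q) (z : Fin p → ℝ) : ℝ :=
  M.gamma01 θ z + (1 - M.gamma01 θ z - M.gamma10 θ z) * M.mu θ z

/-- `a₀(y*, z) = P(Y* = y* | Y = 0, Z = z)`. -/
noncomputable def a0 (θ : Param p q) (ys : Bool) (z : Fin p → ℝ) : ℝ :=
  if ys then M.gamma01 θ z else 1 - M.gamma01 θ z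

/-- `a₁(y*, z) = P(Y* = y* | Y = 1, Z = z)`. -/
noncomputable def a1 (θ : Param p q) (ys : Bool) (z : Fin p → ℝ) : ℝ :=
  if ys then 1 - M.gamma10 θ z else M.gamma10 θ z

/-- The conditional density `f(y, y* | z)`, contributed by a validation subject. -/
noncomputable def densV (θ : Param p q) (y ys : Bool) (z : Fin p → ℝ) : ℝ :=
  if y then M.mu θ z * M.a1 θ ys z else (1 - M.mu θ z) * M.a0 θ ys z

/-- The conditional density `f(y* | z)`, contributed by a subject outside the validation sample. -/
noncomputable def densM (θ : Param p q) (ys : Bool) (z : Fin p → ℝ) : ℝ :=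
  if ys then M.muStar θ z else 1 - M.muStar θ z

/-- `log f(y, y* | z)` as a function of the parameter. -/
noncomputable def logV (o : Obs p) (θ : Param p q) : ℝ :=
  Real.log (M.densV θ o.1 o.2.1 o.2.2)

/-- `log f(y* | z)` as a function of the parameter. -/
noncomputable def logM (o : Obs p) (θ : Param p q) : ℝ :=
  Real.log (M.densM θ o.2.1 o.2.2)

/-- The law `D` of `(Y, Y*, Z)` follows the model with parameter `θ`:
`P(Y = 1 | Z) = μ(Z)`, and `P(Y* = 1 | Y, Z)` is `1 - γ₁₀(Z)` if `Y = 1` and `γ₀₁(Z)` if `Y = 0`.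
The law of `Z` is arbitrary. -/
structure Follows (θ : Param p q) (D : Measure (Obs p)) : Prop where
  response :
    D⟦{o : Obs p | o.1 = true} |
        MeasurableSpace.comap (fun o : Obs p => o.2.2) inferInstance⟧
      =ᵐ[D] fun o => M.mu θ o.2.2
  surrogate :
    D⟦{o : Obs p | o.2.1 = true} |
        MeasurableSpace.comap (fun o : Obs p => (o.1, o.2.2)) inferInstance⟧
      =ᵐ[D] fun o => if o.1 then 1 - M.gamma10 θ o.2.2 else M.gamma01 θ o.2.2

end MisclassModel

/-- The partial derivative `∂F/∂θ_j` at `θ`. -/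
noncomputable def pderiv {p q : ℕ} (j : Unit ⊕ Fin p ⊕ Fin q) (F : Param p q → ℝ)
    (θ : Param p q) : ℝ :=
  fderiv ℝ F θ (EuclideanSpace.single j 1)

/-- The information matrix `E[(∂ log f)(∂ log f)ᵀ]` at `θ`, where `L o` is the log-density of the
observation `o` as a function of the parameter. -/
noncomputable def fisherInfo {p q : ℕ} (D : Measure (Obs p)) (L : Obs p → Param p q → ℝ)
    (θ : Param p q) : Matrix (Unit ⊕ Fin p ⊕ Fin q) (Unit ⊕ Fin p ⊕ Fin q) ℝ :=
  Matrix.of fun j k => ∫ o, pderiv j (L o) θ * pderiv k (L o) θ ∂D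

/-- Classical smoothness and moment conditions on a log-density `L`, at the true value `θ₀` and on
an open set `N` containing it. -/
structure SmoothLogDensity {p q : ℕ} (D : Measure (Obs p)) (L : Obs p → Param p q → ℝ)
    (θ₀ : Param p q) (N : Set (Param p q)) : Prop where
  /-- three continuous derivatives in the parameter, for almost every `z` and all `y`, `y*` -/
  contDiffOn : ∀ᵐ o ∂D, ∀ y ys : Bool, ContDiffOn ℝ 3 (L (y, ys, o.2.2)) N
  /-- square integrable score at the true value -/
  score : ∀ j, MemLp (fun o => pderiv j (L o) θ₀) 2 D
  /-- integrable second derivatives at the true value -/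
  hessian : ∀ j k, Integrable (fun o => pderiv k (pderiv j (L o)) θ₀) D
  /-- third derivatives dominated on `N` by an integrable function of the observation -/
  third : ∃ B : Obs p → ℝ, Integrable B D ∧
    ∀ᵐ o ∂D, ∀ θ ∈ N, ∀ j k l, |pderiv l (pderiv k (pderiv j (L o))) θ| ≤ B o

/-- The regularity conditions on the distributions of the main study and the validation data, with
`δ` the limiting validation ratio and `N` an open set containing the true value `θ₀`. -/
structure RegularityConditions {p q : ℕ} (M : MisclassModel p q) (D : Measure (Obs p)) (δ : ℝ)
    (θ₀ : Param p q) (N : Set (Param p q)) : Prop where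
  isOpen : IsOpen N
  mem : θ₀ ∈ N
  /-- for parameters in `N` the equation defining `μ(z)` is solvable in `(0,1)` -/
  range : ∀ᵐ o ∂D, ∀ θ ∈ N, MisclassModel.linPred θ o.2.2 ∈ M.link '' Set.Ioo 0 1
  smoothV : SmoothLogDensity D M.logV θ₀ N
  smoothM : SmoothLogDensity D M.logM θ₀ N
  /-- positive definiteness of `δ I₁*(θ₀) + (1 - δ) I₂*(θ₀)` -/
  posDef : (δ • fisherInfo D M.logV θ₀ + (1 - δ) • fisherInfo D M.logM θ₀).PosDef

/-- `ρ` is a family of penalty functions `ρ_λ` on `[0, ∞)`, `λ ≥ 0`: continuous, nonnegative and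
zero at `0`. -/
structure IsPenalty (ρ : ℝ → ℝ → ℝ) : Prop where
  continuousOn : ∀ lam, 0 ≤ lam → ContinuousOn (ρ lam) (Set.Ici 0)
  nonneg : ∀ lam, 0 ≤ lam → ∀ ξ, 0 ≤ ξ → 0 ≤ ρ lam ξ
  zero : ∀ lam, 0 ≤ lam → ρ lam 0 = 0

/-- The smoothness condition on the penalty away from the origin: for constants `C` and `D`,
`ρ_{λ_n}` is twice differentiable on `(C λ_n, ∞)` and
`|ρ''_{λ_n}(ξ₁) - ρ''_{λ_n}(ξ₂)| ≤ D |ξ₁ - ξ₂|` for all `ξ₁, ξ₂ > C λ_n`. -/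
def PenaltySmooth (ρ : ℝ → ℝ → ℝ) (lam : ℕ → ℝ) : Prop :=
  ∃ C D : ℝ, 0 < C ∧ ∀ n,
    DifferentiableOn ℝ (ρ (lam n)) (Set.Ioi (C * lam n)) ∧
    DifferentiableOn ℝ (deriv (ρ (lam n))) (Set.Ioi (C * lam n)) ∧
    ∀ ξ₁ > C * lam n, ∀ ξ₂ > C * lam n,
      |deriv (deriv (ρ (lam n))) ξ₁ - deriv (deriv (ρ (lam n))) ξ₂| ≤ D * |ξ₁ - ξ₂|

/-- `a_n = max {|ρ'_{λ_n}(|β_{j0}|)| : β_{j0} ≠ 0}`, which is `0` if all `β_{j0}` vanish. -/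
noncomputable def aSeq {p q : ℕ} (ρ : ℝ → ℝ → ℝ) (lam : ℕ → ℝ) (θ₀ : Param p q) (n : ℕ) : ℝ :=
  ⨆ j : {j : Fin p // θ₀.beta j ≠ 0}, |deriv (ρ (lam n)) (|θ₀.beta j.1|)|

/-- `b_n = max {|ρ''_{λ_n}(|β_{j0}|)| : β_{j0} ≠ 0}`, which is `0` if all `β_{j0}` vanish. -/
noncomputable def bSeq {p q : ℕ} (ρ : ℝ → ℝ → ℝ) (lam : ℕ → ℝ) (θ₀ : Param p q) (n : ℕ) : ℝ :=
  ⨆ j : {j : Fin p // θ₀.beta j ≠ 0}, |deriv (deriv (ρ (lam n))) (|θ₀.beta j.1|)|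

/-- The observed-data log-likelihood `ℓ*(θ)` of the main study sample `{0, …, n-1}` with validation
subsample `V`, for the observations `x i`. -/
noncomputable def logLik {p q : ℕ} (M : MisclassModel p q) (n : ℕ) (V : Finset ℕ) (x : ℕ → Obs p)
    (θ : Param p q) : ℝ :=
  ∑ i ∈ V, M.logV (x i) θ + ∑ i ∈ Finset.range n \ V, M.logM (x i) θ

/-- The penalized observed-data log-likelihood
`Q*_ML(θ) = ℓ*(θ) - n ∑_j ρ_λ(|β_j|)`. -/
noncomputable def penLogLik {p q : ℕ} (M : MisclassModel p q) (ρ : ℝ → ℝ → ℝ) (lam : ℝ) (n : ℕ)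
    (V : Finset ℕ) (x : ℕ → Obs p) (θ : Param p q) : ℝ :=
  logLik M n V x θ - n * ∑ j : Fin p, ρ lam |θ.beta j|

/-- The sampling scheme: the full observations `X i` are i.i.d. with law `D`; for every `n` the main
study sample is `{0, …, n-1}`, and the validation sample `V n` is a random subset of it of size
`nv n`, selected independently of the data. -/
structure ValidationDesign {p : ℕ} {Ω : Type*} [MeasurableSpace Ω] (P : Measure Ω)
    (D : Measure (Obs p)) (X : ℕ → Ω → Obs p) (nv : ℕ → ℕ) (V : ℕ → Ω → Finset ℕ) : Prop where
  measurable_obs : ∀ i, Measurable (X i)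
  law : ∀ i, HasLaw (X i) D P
  indep : iIndepFun X P
  measurable_sel : ∀ n, Measurable (V n)
  subset : ∀ n ω, V n ω ⊆ Finset.range n
  card : ∀ n ω, (V n ω).card = nv n
  indep_sel : ∀ n, IndepFun (V n) (fun ω (i : Fin n) => X i ω) P

/-- `U_n = O_p(r_n)`: for every `ε > 0` there is a `K` such that `P(|U_n| > K r_n) ≤ ε` for all
large `n`. -/
def IsBigOInProb {Ω : Type*} [MeasurableSpace Ω] (P : Measure Ω) (U : ℕ → Ω → ℝ) (r : ℕ → ℝ) :
    Prop :=
  ∀ ε : ℝ, 0 < ε → ∃ K : ℝ, ∀ᶠ n in atTop, P {ω | K * r n < |U n ω|} ≤ ENNReal.ofReal ε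

/-!
With high probability the penalized likelihood is smaller on the sphere of radius
`K (n ^ (-1 / 2) + a_n)` around `θ₀` than at `θ₀` itself, once `K` is large, so it has a local
maximizer inside. Indeed, in the Taylor expansion at `θ₀` the score is `O_p(√n)` and the Hessian
over `n` tends to `-(δ I₁* + (1 - δ) I₂*)`, both by Bartlett's identities; the penalty lowers
itself only through the coefficients with `β_{j0} ≠ 0`, by at most a multiple of `n a_n` per unit
of radius. The random validation sample does no harm: being independent of the data, it makes a sum
over it distributed like the sum over its first `n_v` terms. A measurable estimator is obtained by
maximizing, with a measurable selection, over the ball with the least admissible `K`.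
-/

section MeasurableArgmax

variable {Ω C : Type*} [MeasurableSpace Ω]

lemma measurable_iSup_of_continuous [TopologicalSpace C] [TopologicalSpace.SeparableSpace C]
    {G : Ω → C → ℝ} (hm : ∀ c, Measurable fun ω => G ω c) (hc : ∀ ω, Continuous (G ω)) :
    Measurable fun ω => ⨆ c, G ω c := by
  obtain ⟨S, hS, hSd⟩ := TopologicalSpace.exists_countable_dense C
  have := hS.to_subtype
  simp_rw [← fun ω => hSd.ciSup' (hc ω)]
  exact Measurable.iSup fun c => hm c

lemma measurableSet_exists_isMaxOn_univ [MetricSpace C] [CompactSpace C] {G : Ω → C → ℝ}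
    (hm : ∀ c, Measurable fun ω => G ω c) (hc : ∀ ω, Continuous (G ω)) {T : Set C}
    (hT : IsClosed T) : MeasurableSet {ω | ∃ c ∈ T, IsMaxOn (G ω) Set.univ c} := by
  rcases T.eq_empty_or_nonempty with rfl | hne
  · simp
  have := hne.to_subtype
  have hcT (ω : Ω) : Continuous fun c : T => G ω c := (hc ω).comp continuous_subtype_val
  have hbdd (ω : Ω) : BddAbove (Set.range (G ω)) := (isCompact_range (hc ω)).bddAbove
  have : CompactSpace T := isCompact_iff_compactSpace.1 hT.isCompact
  have heq : {ω | ∃ c ∈ T, IsMaxOn (G ω) Set.univ c} = {ω | ⨆ c, G ω c ≤ ⨆ c : T, G ω c} := by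
    ext ω
    constructor
    · rintro ⟨c, hcT', hmax⟩
      have : Nonempty C := ⟨c⟩
      exact ciSup_le fun c' => le_ciSup_of_le (isCompact_range (hcT ω)).bddAbove ⟨c, hcT'⟩
        (hmax (Set.mem_univ c'))
    · intro hle
      obtain ⟨c, -, hmax⟩ := isCompact_univ.exists_isMaxOn Set.univ_nonempty (hcT ω).continuousOn
      exact ⟨c, c.2, fun c' _ => (le_ciSup (hbdd ω) c').trans
        (hle.trans (ciSup_le fun c'' => hmax (Set.mem_univ c'')))⟩
  rw [heq]
  exact measurableSet_le (measurable_iSup_of_continuous hm hc)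
    (measurable_iSup_of_continuous (fun c : T => hm c) hcT)

lemma exists_measurable_argmax_cantorSet {G : Ω → cantorSet → ℝ}
    (hm : ∀ c, Measurable fun ω => G ω c) (hc : ∀ ω, Continuous (G ω)) :
    ∃ τ : Ω → cantorSet, Measurable τ ∧ ∀ ω, IsMaxOn (G ω) Set.univ (τ ω) := by
  have : CompactSpace cantorSet := isCompact_iff_compactSpace.1 isCompact_cantorSet
  have : Nonempty cantorSet := ⟨cantorSetHomeomorphNatToBool.symm fun _ => false⟩
  have hleast (ω : Ω) : ∃ c, IsLeast {c | IsMaxOn (G ω) Set.univ c} c := by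
    have hcl : IsClosed {c | IsMaxOn (G ω) Set.univ c} := by
      simp only [isMaxOn_iff, Set.ofPred_forall]
      exact isClosed_iInter fun _ => isClosed_iInter fun _ =>
        isClosed_le continuous_const (hc ω)
    refine hcl.isCompact.exists_isLeast ?_
    obtain ⟨c, -, hmax⟩ := isCompact_univ.exists_isMaxOn Set.univ_nonempty (hc ω).continuousOn
    exact ⟨c, hmax⟩
  choose τ hτ using hleast
  refine ⟨τ, ?_, fun ω => (hτ ω).1⟩
  have hcoe : Measurable fun ω => (τ ω : ℝ) := by
    refine measurable_of_Iic fun s => ?_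
    have heq : (fun ω => (τ ω : ℝ)) ⁻¹' Set.Iic s =
        {ω | ∃ c ∈ (Subtype.val ⁻¹' Set.Iic s : Set cantorSet), IsMaxOn (G ω) Set.univ c} := by
      ext ω
      exact ⟨fun h => ⟨τ ω, h, (hτ ω).1⟩, fun ⟨c, hcs, hmax⟩ =>
        le_trans (Subtype.coe_le_coe.2 ((hτ ω).2 hmax)) hcs⟩
    rw [heq]
    exact measurableSet_exists_isMaxOn_univ hm hc (isClosed_Iic.preimage continuous_subtype_val)
  exact hcoe.subtype_mk (h := fun ω => (τ ω).2)

-- The Cantor set maps continuously onto `S`, and its linear order selects the least maximizer.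
lemma exists_measurable_argmax {E : Type*} [MetricSpace E] [MeasurableSpace E] [BorelSpace E]
    {S : Set E} (hS : IsCompact S) (hne : S.Nonempty) {F : Ω → E → ℝ}
    (hm : ∀ θ ∈ S, Measurable fun ω => F ω θ) (hc : ∀ ω, ContinuousOn (F ω) S) :
    ∃ t : Ω → E, Measurable t ∧ ∀ ω, t ω ∈ S ∧ IsMaxOn (F ω) S (t ω) := by
  have : CompactSpace S := isCompact_iff_compactSpace.1 hS
  have : Nonempty S := hne.to_subtype
  obtain ⟨f, hf, hfs⟩ := exists_nat_bool_continuous_surjective_of_compact S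
  have hφ : Continuous (f ∘ cantorSetHomeomorphNatToBool) :=
    hf.comp cantorSetHomeomorphNatToBool.continuous
  have hφs : Function.Surjective (f ∘ cantorSetHomeomorphNatToBool) :=
    hfs.comp cantorSetHomeomorphNatToBool.surjective
  obtain ⟨τ, hτm, hτ⟩ := exists_measurable_argmax_cantorSet
    (G := fun ω c => F ω (f (cantorSetHomeomorphNatToBool c))) (fun c => hm _ (f _).2)
    (fun ω => (continuousOn_iff_continuous_domRestrict.1 (hc ω)).comp hφ)
  refine ⟨fun ω => f (cantorSetHomeomorphNatToBool (τ ω)),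
    (measurable_subtype_coe.comp hφ.measurable).comp hτm, fun ω => ⟨(f _).2, fun θ hθ => ?_⟩⟩
  obtain ⟨c, hcθ⟩ := hφs ⟨θ, hθ⟩
  simpa [show f (cantorSetHomeomorphNatToBool c) = ⟨θ, hθ⟩ from hcθ] using
    hτ ω (Set.mem_univ c)

lemma exists_measurable_argmax_ae {E : Type*} [MetricSpace E] [MeasurableSpace E] [BorelSpace E]
    {P : Measure Ω} {S : Set E} (hS : IsCompact S) (hne : S.Nonempty) {F : Ω → E → ℝ}
    (hm : ∀ θ ∈ S, Measurable fun ω => F ω θ) (hc : ∀ᵐ ω ∂P, ContinuousOn (F ω) S) :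
    ∃ t : Ω → E, Measurable t ∧ (∀ ω, t ω ∈ S) ∧ ∀ᵐ ω ∂P, IsMaxOn (F ω) S (t ω) := by
  classical
  obtain ⟨Z, hZ, hZm, hZ0⟩ := exists_measurable_superset_of_null (ae_iff.1 hc)
  obtain ⟨t, htm, ht⟩ := exists_measurable_argmax hS hne
    (F := fun ω θ => if ω ∈ Z then 0 else F ω θ)
    (fun θ hθ => Measurable.ite hZm measurable_const (hm θ hθ)) (fun ω => by
      by_cases hω : ω ∈ Z
      · simpa only [hω, if_true] using continuousOn_const
      · simpa only [hω, if_false] using not_not.1 fun h => hω (hZ h))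
  refine ⟨t, htm, fun ω => (ht ω).1, ?_⟩
  filter_upwards [measure_eq_zero_iff_ae_notMem.1 hZ0] with ω hω
  simpa only [hω, if_false] using (ht ω).2

end MeasurableArgmax

section LocalMaximizers

variable {Ω E : Type*} [MeasurableSpace Ω] {P : Measure Ω}

lemma exists_measurable_min_index [MeasurableSpace E] {t : ℕ → Ω → E}
    (ht : ∀ k, Measurable (t k)) {G : ℕ → Set Ω} (hG : ∀ k, MeasurableSet (G k)) :
    ∃ s : Ω → E, Measurable s ∧ ∀ k, ∀ ω ∈ G k, ∃ l ≤ k, ω ∈ G l ∧ s ω = t l ω := by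
  classical
  have hfind (ω : Ω) : ∃ k, ω ∈ G k ∨ ω ∈ (⋃ l, G l)ᶜ := by
    by_cases h : ω ∈ ⋃ l, G l
    · exact (Set.mem_iUnion.1 h).imp fun _ => Or.inl
    · exact ⟨0, Or.inr h⟩
  refine ⟨fun ω => t (Nat.find (hfind ω)) ω, ?_, fun k ω hk => ?_⟩
  · exact Measurable.find (f := t) (p := fun k ω => ω ∈ G k ∨ ω ∈ (⋃ l, G l)ᶜ) ht
      (fun k => (hG k).union (MeasurableSet.iUnion hG).compl) hfind
  · exact ⟨Nat.find (hfind ω), Nat.find_min' _ (Or.inl hk),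
      (Nat.find_spec (hfind ω)).resolve_right fun h => h (Set.mem_iUnion.2 ⟨k, hk⟩), rfl⟩

lemma mem_ball_of_isMaxOn_closedBall [PseudoMetricSpace E] {f : E → ℝ} {x₀ x : E} {r : ℝ}
    (hmax : IsMaxOn f (Metric.closedBall x₀ r) x) (hx : x ∈ Metric.closedBall x₀ r)
    (hlt : ∀ y ∈ Metric.sphere x₀ r, f y < f x₀) : x ∈ Metric.ball x₀ r := by
  refine lt_of_le_of_ne (Metric.mem_closedBall.1 hx) fun heq => ?_
  have hr : 0 ≤ r := dist_nonneg.trans_eq heq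
  exact (hlt x heq).not_ge (hmax (Metric.mem_closedBall_self hr))

variable [NormedAddCommGroup E] [ProperSpace E] [MeasurableSpace E] [BorelSpace E]

lemma exists_measurable_isLocalMax_of_sphere_lt {F : Ω → E → ℝ} {x₀ : E} {R : ℝ} {r : ℕ → ℝ}
    (hm : ∀ x ∈ Metric.closedBall x₀ R, Measurable fun ω => F ω x)
    (hc : ∀ᵐ ω ∂P, ContinuousOn (F ω) (Metric.closedBall x₀ R))
    (hr0 : ∀ k, 0 ≤ r k) (hr : Monotone r) (hrR : ∀ k, r k ≤ R) :
    ∃ s : Ω → E, Measurable s ∧ ∀ᵐ ω ∂P, ∀ k,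
      (∀ y ∈ Metric.sphere x₀ (r k), F ω y < F ω x₀) →
        IsLocalMax (F ω) (s ω) ∧ ‖s ω - x₀‖ ≤ r k := by
  have hsub (k : ℕ) : Metric.closedBall x₀ (r k) ⊆ Metric.closedBall x₀ R :=
    Metric.closedBall_subset_closedBall (hrR k)
  have hex (k : ℕ) := exists_measurable_argmax_ae (P := P) (F := F)
    (isCompact_closedBall x₀ (r k)) (Metric.nonempty_closedBall.2 (hr0 k))
    (fun x hx => hm x (hsub k hx)) (hc.mono fun ω h => h.mono (hsub k))
  choose t htm htr ht using hex
  obtain ⟨s, hsm, hs⟩ :=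
    exists_measurable_min_index htm (G := fun k => t k ⁻¹' Metric.ball x₀ (r k))
    fun k => htm k Metric.isOpen_ball.measurableSet
  refine ⟨s, hsm, ?_⟩
  filter_upwards [ae_all_iff.2 ht] with ω hω k hk
  obtain ⟨l, hlk, hl, hsl⟩ := hs k ω (mem_ball_of_isMaxOn_closedBall (hω k) (htr k ω) hk)
  rw [hsl]
  exact ⟨(hω l).isLocalMax (mem_of_superset (Metric.isOpen_ball.mem_nhds hl)
    Metric.ball_subset_closedBall), (mem_ball_iff_norm.1 hl).le.trans (hr hlk)⟩

theorem exists_measurable_isLocalMax {Q : ℕ → Ω → E → ℝ} {x₀ : E} {α : ℕ → ℝ} {R : ℝ}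
    (hR : 0 < R) (hm : ∀ n, ∀ x ∈ Metric.closedBall x₀ R, Measurable fun ω => Q n ω x)
    (hc : ∀ n, ∀ᵐ ω ∂P, ContinuousOn (Q n ω) (Metric.closedBall x₀ R))
    (hα0 : ∀ n, 0 ≤ α n) (hα : Tendsto α atTop (𝓝 0))
    (hlt : ∀ ε : ℝ, 0 < ε → ∃ K : ℕ, ∀ᶠ n in atTop,
      P {ω | ¬ ∀ h : E, ‖h‖ = K * α n → Q n ω (x₀ + h) < Q n ω x₀} ≤ ENNReal.ofReal ε) :
    ∃ est : ℕ → Ω → E, (∀ n, Measurable (est n)) ∧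
      Tendsto (fun n => P {ω | ¬ IsLocalMax (Q n ω) (est n ω)}) atTop (𝓝 0) ∧
      IsBigOInProb P (fun n ω => ‖est n ω - x₀‖) α := by
  have hex (n : ℕ) := exists_measurable_isLocalMax_of_sphere_lt (r := fun K => min (K * α n) R)
    (hm n) (hc n) (fun K => le_min (mul_nonneg K.cast_nonneg (hα0 n)) hR.le)
    (fun K L hKL => min_le_min_right R
      (mul_le_mul_of_nonneg_right (Nat.cast_le.2 hKL) (hα0 n))) (fun K => min_le_right _ _)
  choose est hest hmax using hex
  have hbad (ε : ℝ) (hε : 0 < ε) : ∃ K : ℕ, ∀ᶠ n in atTop,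
      P {ω | ¬ (IsLocalMax (Q n ω) (est n ω) ∧ ‖est n ω - x₀‖ ≤ K * α n)} ≤ ENNReal.ofReal ε := by
    obtain ⟨K, hK⟩ := hlt ε hε
    have hKα : Tendsto (fun n => K * α n) atTop (𝓝 0) := by simpa using hα.const_mul (K : ℝ)
    refine ⟨K, ?_⟩
    filter_upwards [hK, hKα.eventually (gt_mem_nhds hR)] with n hn hKR
    refine (measure_mono_ae ?_).trans hn
    filter_upwards [hmax n] with ω hω hnot hsphere
    have := hω K
    rw [min_eq_left hKR.le] at this
    refine hnot (this fun y hy => ?_)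
    simpa using hsphere (y - x₀) (mem_sphere_iff_norm.1 hy)
  refine ⟨est, hest, ENNReal.tendsto_nhds_zero.2 fun ε hε => ?_, fun ε hε => ?_⟩
  · obtain ⟨e, he0, hee⟩ := ENNReal.lt_iff_exists_nnreal_btwn.1 hε
    obtain ⟨K, hK⟩ := hbad e (by exact_mod_cast he0)
    filter_upwards [hK] with n hn
    rw [ENNReal.ofReal_coe_nnreal] at hn
    exact (measure_mono fun _ => mt And.left).trans (hn.trans hee.le)
  · obtain ⟨K, hK⟩ := hbad ε hε
    refine ⟨K, hK.mono fun n hn => (measure_mono fun ω hω h => ?_).trans hn⟩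
    rw [Set.mem_ofPred_eq, abs_norm] at hω
    exact hω.not_ge h.2

end LocalMaximizers

section Calculus

lemma abs_sum_mul_le_norm_mul_sum_abs {ι : Type*} [Fintype ι] (h : EuclideanSpace ℝ ι)
    (f : ι → ℝ) : |∑ j, h j * f j| ≤ ‖h‖ * ∑ j, |f j| := by
  rw [Finset.mul_sum]
  refine (Finset.abs_sum_le_sum_abs _ _).trans (Finset.sum_le_sum fun j _ => ?_)
  rw [abs_mul]
  exact mul_le_mul_of_nonneg_right (by simpa using PiLp.norm_apply_le h j) (abs_nonneg _)

lemma abs_sum_mul_sum_mul_le_norm_sq_mul_sum_abs {ι : Type*} [Fintype ι]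
    (h : EuclideanSpace ℝ ι) (f : ι → ι → ℝ) :
    |∑ j, h j * ∑ k, h k * f j k| ≤ ‖h‖ ^ 2 * ∑ j, ∑ k, |f j k| := by
  calc |∑ j, h j * ∑ k, h k * f j k|
      ≤ ‖h‖ * ∑ j, |∑ k, h k * f j k| := abs_sum_mul_le_norm_mul_sum_abs h _
    _ ≤ ‖h‖ * ∑ j, ‖h‖ * ∑ k, |f j k| := by
        gcongr with j
        exact abs_sum_mul_le_norm_mul_sum_abs h _
    _ = ‖h‖ ^ 2 * ∑ j, ∑ k, |f j k| := by rw [← Finset.mul_sum, sq, mul_assoc]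

lemma abs_sub_le_of_abs_deriv_le {f f' : ℝ → ℝ} {K : ℝ}
    (hf : ∀ t ∈ Set.Icc (0 : ℝ) 1, HasDerivAt f (f' t) t)
    (hf' : ∀ t ∈ Set.Icc (0 : ℝ) 1, |f' t| ≤ K) {t : ℝ} (ht : t ∈ Set.Icc (0 : ℝ) 1) :
    |f t - f 0| ≤ K := by
  have hK : 0 ≤ K := (abs_nonneg _).trans (hf' t ht)
  have hmvt := norm_image_sub_le_of_norm_deriv_le_segment'
    (fun s hs => (hf s hs).hasDerivWithinAt) (fun s hs => hf' s (Set.Ico_subset_Icc_self hs)) t ht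
  rw [sub_zero] at hmvt
  exact hmvt.trans (mul_le_of_le_one_right hK ht.2)

lemma abs_sub_taylor_two_le_of_abs_deriv_le {φ φ₁ φ₂ φ₃ : ℝ → ℝ} {K : ℝ}
    (h₀ : ∀ t ∈ Set.Icc (0 : ℝ) 1, HasDerivAt φ (φ₁ t) t)
    (h₁ : ∀ t ∈ Set.Icc (0 : ℝ) 1, HasDerivAt φ₁ (φ₂ t) t)
    (h₂ : ∀ t ∈ Set.Icc (0 : ℝ) 1, HasDerivAt φ₂ (φ₃ t) t)
    (h₃ : ∀ t ∈ Set.Icc (0 : ℝ) 1, |φ₃ t| ≤ K) :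
    |φ 1 - φ 0 - φ₁ 0 - φ₂ 0 / 2| ≤ K := by
  have hφ₁ : ∀ t ∈ Set.Icc (0 : ℝ) 1, |φ₁ t - φ₂ 0 * t - φ₁ 0| ≤ K := fun t ht => by
    simpa using abs_sub_le_of_abs_deriv_le (f := fun t => φ₁ t - φ₂ 0 * t)
      (fun t ht => ((h₁ t ht).sub ((hasDerivAt_id t).const_mul (φ₂ 0))).congr_deriv
        (by rw [mul_one])) (fun t => abs_sub_le_of_abs_deriv_le h₂ h₃) ht
  have hφ := abs_sub_le_of_abs_deriv_le (f := fun t => φ t - φ₁ 0 * t - φ₂ 0 * t ^ 2 / 2)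
    (fun t ht => (((h₀ t ht).sub ((hasDerivAt_id t).const_mul (φ₁ 0))).sub
      ((((hasDerivAt_id t).pow 2).const_mul (φ₂ 0)).div_const 2)).congr_deriv
        (by simp only [id_eq]; ring)) hφ₁ (Set.right_mem_Icc.2 zero_le_one)
  convert hφ using 2
  ring

variable {p q : ℕ} {F : Param p q → ℝ} {N : Set (Param p q)} {x h : Param p q}

lemma fderiv_apply_eq_sum_pderiv (F : Param p q → ℝ) (x h : Param p q) :
    fderiv ℝ F x h = ∑ j, h j * pderiv j F x := by
  have hh : h = ∑ j, h j • EuclideanSpace.single j (1 : ℝ) := by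
    ext i
    simp [Pi.single_apply, -Fintype.sum_sum_type]
  conv_lhs => rw [hh]
  simp [map_sum, pderiv, -Fintype.sum_sum_type]

lemma hasDerivAt_comp_line {t : ℝ} (hF : DifferentiableAt ℝ F (x + t • h)) :
    HasDerivAt (fun s : ℝ => F (x + s • h)) (∑ j, h j * pderiv j F (x + t • h)) t := by
  rw [← fderiv_apply_eq_sum_pderiv]
  have hline : HasDerivAt (fun s : ℝ => x + s • h) h t := by
    simpa using ((hasDerivAt_id t).smul_const h).const_add x
  exact hF.hasFDerivAt.comp_hasDerivAt t hline

lemma contDiffOn_pderiv (hN : IsOpen N) {n : ℕ} (hF : ContDiffOn ℝ (n + 1) F N)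
    (j : Unit ⊕ Fin p ⊕ Fin q) : ContDiffOn ℝ n (pderiv j F) N :=
  (hF.fderiv_of_isOpen hN le_rfl).clm_apply contDiffOn_const

lemma abs_sub_taylor_two_pderiv_le (hN : IsOpen N) (hF : ContDiffOn ℝ 3 F N)
    (hseg : ∀ t ∈ Set.Icc (0 : ℝ) 1, x + t • h ∈ N) {B : ℝ}
    (hB : ∀ θ ∈ N, ∀ j k l, |pderiv l (pderiv k (pderiv j F)) θ| ≤ B) :
    |F (x + h) - F x - ∑ j, h j * pderiv j F x
      - (∑ j, h j * ∑ k, h k * pderiv k (pderiv j F) x) / 2|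
      ≤ Fintype.card (Unit ⊕ Fin p ⊕ Fin q) ^ 3 * B * ‖h‖ ^ 3 := by
  have hF₁ (j) : ContDiffOn ℝ 2 (pderiv j F) N := contDiffOn_pderiv (n := 2) hN hF j
  have hF₂ (j k) : ContDiffOn ℝ 1 (pderiv k (pderiv j F)) N :=
    contDiffOn_pderiv (n := 1) hN (hF₁ j) k
  have hline {G : Param p q → ℝ} {n : ℕ∞} (hn : n ≠ 0) (hG : ContDiffOn ℝ n G N) (t : ℝ)
      (ht : t ∈ Set.Icc (0 : ℝ) 1) :
      HasDerivAt (fun s : ℝ => G (x + s • h)) (∑ j, h j * pderiv j G (x + t • h)) t :=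
    hasDerivAt_comp_line ((hG.contDiffAt (hN.mem_nhds (hseg t ht))).differentiableAt
      (by exact_mod_cast hn))
  have hthird : ∀ t ∈ Set.Icc (0 : ℝ) 1, |∑ j, h j * ∑ k, h k * ∑ l, h l *
      pderiv l (pderiv k (pderiv j F)) (x + t • h)|
        ≤ Fintype.card (Unit ⊕ Fin p ⊕ Fin q) ^ 3 * B * ‖h‖ ^ 3 := fun t ht =>
    calc |∑ j, h j * ∑ k, h k * ∑ l, h l * pderiv l (pderiv k (pderiv j F)) (x + t • h)|
        ≤ ‖h‖ ^ 2 * ∑ j, ∑ k, |∑ l, h l * pderiv l (pderiv k (pderiv j F)) (x + t • h)| :=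
          abs_sum_mul_sum_mul_le_norm_sq_mul_sum_abs h _
      _ ≤ ‖h‖ ^ 2 * ∑ _j : Unit ⊕ Fin p ⊕ Fin q, ∑ _k : Unit ⊕ Fin p ⊕ Fin q,
            ‖h‖ * ∑ _l : Unit ⊕ Fin p ⊕ Fin q, B := by
          gcongr with j _ k
          refine (abs_sum_mul_le_norm_mul_sum_abs h _).trans ?_
          gcongr with l
          exact hB _ (hseg t ht) j k l
      _ = Fintype.card (Unit ⊕ Fin p ⊕ Fin q) ^ 3 * B * ‖h‖ ^ 3 := by
          simp only [Finset.sum_const, Finset.card_univ, nsmul_eq_mul]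
          ring
  simpa only [one_smul, zero_smul, add_zero] using abs_sub_taylor_two_le_of_abs_deriv_le
    (hline three_ne_zero hF)
    (fun t ht => HasDerivAt.fun_sum fun j _ => (hline two_ne_zero (hF₁ j) t ht).const_mul (h j))
    (fun t ht => HasDerivAt.fun_sum fun j _ => HasDerivAt.const_mul (h j) <|
      HasDerivAt.fun_sum fun k _ => (hline one_ne_zero (hF₂ j k) t ht).const_mul (h k)) hthird

end Calculus

section Bartlett

variable {p q : ℕ} {N : Set (Param p q)} {x : Param p q}

lemma pderiv_exp_mul {L G : Param p q → ℝ} (hL : DifferentiableAt ℝ L x)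
    (hG : DifferentiableAt ℝ G x) (k : Unit ⊕ Fin p ⊕ Fin q) :
    pderiv k (fun θ => Real.exp (L θ) * G θ) x
      = Real.exp (L x) * (pderiv k G x + G x * pderiv k L x) := by
  have hfderiv := (hL.hasFDerivAt.exp.mul hG.hasFDerivAt).fderiv
  unfold pderiv
  rw [show (fun θ => Real.exp (L θ) * G θ) = (fun θ => Real.exp (L θ)) * G from rfl, hfderiv]
  simp only [add_apply, smul_apply, smul_eq_mul]
  ring

lemma sum_pderiv_eq_zero_of_sum_eq_const {ι : Type*} [Fintype ι] {F : ι → Param p q → ℝ}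
    (hN : IsOpen N) (hx : x ∈ N) (hF : ∀ i, DifferentiableAt ℝ (F i) x) {c : ℝ}
    (hc : ∀ θ ∈ N, ∑ i, F i θ = c) (k : Unit ⊕ Fin p ⊕ Fin q) :
    ∑ i, pderiv k (F i) x = 0 := by
  have hconst : (fun θ => ∑ i, F i θ) =ᶠ[𝓝 x] fun _ => c := by
    filter_upwards [hN.mem_nhds hx] with θ hθ using hc θ hθ
  have hfderiv := hconst.fderiv_eq (𝕜 := ℝ)
  rw [fderiv_fun_sum fun i _ => hF i, fderiv_fun_const] at hfderiv
  simpa [pderiv] using congrArg (fun A => A (EuclideanSpace.single k 1)) hfderiv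

variable {ι : Type*} [Fintype ι] {L : ι → Param p q → ℝ}

lemma sum_exp_mul_pderiv_eq_zero (hN : IsOpen N) (hL : ∀ i, DifferentiableOn ℝ (L i) N)
    (hsum : ∀ θ ∈ N, ∑ i, Real.exp (L i θ) = 1) (hx : x ∈ N) (j : Unit ⊕ Fin p ⊕ Fin q) :
    ∑ i, Real.exp (L i x) * pderiv j (L i) x = 0 := by
  have hLx (i : ι) : DifferentiableAt ℝ (L i) x := (hL i).differentiableAt (hN.mem_nhds hx)
  rw [← sum_pderiv_eq_zero_of_sum_eq_const hN hx (F := fun i θ => Real.exp (L i θ) * 1)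
    (fun i => (hLx i).exp.mul_const 1) (by simpa only [mul_one] using hsum) j]
  refine Finset.sum_congr rfl fun i _ => ?_
  rw [pderiv_exp_mul (hLx i) (differentiableAt_const 1)]
  simp [pderiv]

lemma sum_exp_mul_pderiv_pderiv_add_eq_zero (hN : IsOpen N)
    (hL : ∀ i, ContDiffOn ℝ 2 (L i) N)
    (hsum : ∀ θ ∈ N, ∑ i, Real.exp (L i θ) = 1) (hx : x ∈ N) (j k : Unit ⊕ Fin p ⊕ Fin q) :
    ∑ i, Real.exp (L i x) *
      (pderiv k (pderiv j (L i)) x + pderiv j (L i) x * pderiv k (L i) x) = 0 := by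
  have hL₁ (i : ι) : DifferentiableOn ℝ (L i) N := (hL i).differentiableOn two_ne_zero
  have hL₂ (i : ι) : DifferentiableOn ℝ (pderiv j (L i)) N :=
    (contDiffOn_pderiv (n := 1) hN (hL i) j).differentiableOn one_ne_zero
  have hLx (i : ι) : DifferentiableAt ℝ (L i) x := (hL₁ i).differentiableAt (hN.mem_nhds hx)
  have hLjx (i : ι) : DifferentiableAt ℝ (pderiv j (L i)) x :=
    (hL₂ i).differentiableAt (hN.mem_nhds hx)
  rw [← sum_pderiv_eq_zero_of_sum_eq_const hN hx
    (F := fun i θ => Real.exp (L i θ) * pderiv j (L i) θ)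
    (fun i => (hLx i).exp.fun_mul (hLjx i))
    (fun θ hθ => sum_exp_mul_pderiv_eq_zero hN hL₁ hsum hθ j) k]
  exact Finset.sum_congr rfl fun i _ => (pderiv_exp_mul (hLx i) (hLjx i) k).symm

end Bartlett

section ConditionalProbability

variable {Ω : Type*} {m m₁ m0 : MeasurableSpace Ω} {μ : Measure Ω}

lemma condProb_nonneg {A : Set Ω} : 0 ≤ᵐ[μ] μ⟦A | m⟧ :=
  condExp_nonneg (ae_of_all _ fun _ => Set.indicator_nonneg (fun _ _ => zero_le_one) _)

variable [IsFiniteMeasure μ]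

lemma condProb_compl (hm : m ≤ m0) {A : Set Ω} (hA : MeasurableSet A) :
    μ⟦Aᶜ | m⟧ =ᵐ[μ] fun ω => 1 - (μ⟦A | m⟧) ω := by
  rw [Set.indicator_compl]
  filter_upwards [condExp_sub (integrable_const (1 : ℝ))
    ((integrable_const 1).indicator hA) m] with ω hω
  rw [hω, condExp_const hm, Pi.sub_apply]

lemma condProb_preimage_bool (hm : m ≤ m0) {T : Ω → Bool} (hT : Measurable T) {f : Ω → ℝ}
    (hf : μ⟦{ω | T ω = true} | m⟧ =ᵐ[μ] f) (b : Bool) :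
    μ⟦{ω | T ω = b} | m⟧ =ᵐ[μ] fun ω => if b then f ω else 1 - f ω := by
  cases b
  · have hcompl : {ω | T ω = false} = {ω | T ω = true}ᶜ := by ext; simp
    rw [hcompl]
    filter_upwards [condProb_compl hm (A := {ω | T ω = true}) (hT (measurableSet_singleton true)),
      hf] with ω hω hfω
    simp only [hω, hfω, Bool.false_eq_true, if_false]
  · simpa only [if_true] using hf

lemma condProb_inter (hm : m ≤ m₁) (hm₁ : m₁ ≤ m0) {A B : Set Ω} (hA : MeasurableSet[m₁] A)
    (hB : MeasurableSet B) {f : Ω → ℝ} (hfm : StronglyMeasurable[m] f) (hfi : Integrable f μ)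
    (hf : ∀ᵐ ω ∂μ, ω ∈ A → (μ⟦B | m₁⟧) ω = f ω) :
    μ⟦A ∩ B | m⟧ =ᵐ[μ] fun ω => f ω * (μ⟦A | m⟧) ω := by
  have hmul : A.indicator f = f * A.indicator fun _ => (1 : ℝ) := by
    ext ω
    by_cases h : ω ∈ A <;> simp [h]
  have hinner : μ⟦A ∩ B | m₁⟧ =ᵐ[μ] f * A.indicator fun _ => (1 : ℝ) := by
    rw [← Set.indicator_indicator, ← hmul]
    filter_upwards [condExp_indicator ((integrable_const (1 : ℝ)).indicator hB) hA, hf]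
      with ω hω hfω
    rw [hω]
    by_cases h : ω ∈ A <;> simp [h, hfω]
  calc μ⟦A ∩ B | m⟧ =ᵐ[μ] μ[μ⟦A ∩ B | m₁⟧ | m] := (condExp_condExp_of_le hm hm₁).symm
    _ =ᵐ[μ] μ[f * A.indicator fun _ => (1 : ℝ) | m] := condExp_congr_ae hinner
    _ =ᵐ[μ] fun ω => f ω * (μ⟦A | m⟧) ω :=
      condExp_mul_of_stronglyMeasurable_left hfm (hmul ▸ hfi.indicator (hm₁ _ hA))
        ((integrable_const 1).indicator (hm₁ _ hA))

lemma measure_inter_eq_setLIntegral_condProb (hm : m ≤ m0) {A S : Set Ω} (hA : MeasurableSet A)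
    (hS : MeasurableSet[m] S) {f : Ω → ℝ} (hf : μ⟦A | m⟧ =ᵐ[μ] f) :
    μ (S ∩ A) = ∫⁻ ω in S, ENNReal.ofReal (f ω) ∂μ := by
  calc μ (S ∩ A) = ENNReal.ofReal (∫ ω in S, A.indicator (fun _ => (1 : ℝ)) ω ∂μ) := by
        rw [setIntegral_indicator hA, setIntegral_const, smul_eq_mul, mul_one, ofReal_measureReal]
    _ = ENNReal.ofReal (∫ ω in S, (μ⟦A | m⟧) ω ∂μ) := by
        rw [setIntegral_condExp hm ((integrable_const 1).indicator hA) hS]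
    _ = ∫⁻ ω in S, ENNReal.ofReal ((μ⟦A | m⟧) ω) ∂μ :=
        ofReal_integral_eq_lintegral_ofReal integrable_condExp.integrableOn
          (ae_restrict_of_ae condProb_nonneg)
    _ = ∫⁻ ω in S, ENNReal.ofReal (f ω) ∂μ :=
        lintegral_congr_ae (ae_restrict_of_ae (hf.mono fun ω hω => congrArg ENNReal.ofReal hω))

end ConditionalProbability

lemma measurable_invFunOn {f : ℝ → ℝ} {s : Set ℝ} (hf : StrictMonoOn f s ∨ StrictAntiOn f s)
    (hs : MeasurableSet (f '' s)) : Measurable (Function.invFunOn f s) := by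
  have hmem (b : f '' s) : Function.invFunOn f s b ∈ s := Function.invFunOn_mem b.2
  have heq (b : f '' s) : f (Function.invFunOn f s b) = b := Function.invFunOn_eq b.2
  refine measurable_of_restrict_of_restrict_compl hs ?_ ?_
  · rcases hf with hf | hf
    · refine Monotone.measurable fun a b hab => ?_
      rwa [Set.domRestrict_apply, Set.domRestrict_apply, ← hf.le_iff_le (hmem a) (hmem b),
        heq, heq]
    · refine Antitone.measurable fun a b hab => ?_
      rwa [Set.domRestrict_apply, Set.domRestrict_apply, ← hf.le_iff_ge (hmem a) (hmem b),
        heq, heq]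
  · rw [show (f '' s)ᶜ.domRestrict (Function.invFunOn f s) = fun _ => _ from
      funext fun b => Function.invFunOn_neg b.2]
    exact measurable_const

namespace MisclassModel

variable {p q : ℕ} (M : MisclassModel p q) (θ : Param p q)

@[fun_prop]
lemma measurable_mu : Measurable (M.mu θ) := by
  have himage : MeasurableSet (M.link '' Set.Ioo 0 1) :=
    (isPreconnected_Ioo.image _ M.link_differentiable.continuousOn).ordConnected.measurableSet
  refine (measurable_invFunOn M.link_monotone himage).comp ?_
  unfold linPred
  fun_prop

@[fun_prop]
lemma measurable_gamma01 : Measurable (M.gamma01 θ) :=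
  continuous_sigmoid.measurable.comp (M.measurable_g₀ θ.nu)

@[fun_prop]
lemma measurable_gamma10 : Measurable (M.gamma10 θ) :=
  continuous_sigmoid.measurable.comp (M.measurable_g₁ θ.nu)

@[fun_prop]
lemma measurable_a0 (ys : Bool) : Measurable (M.a0 θ ys) := by
  cases ys <;> unfold a0 <;> simp only [Bool.false_eq_true, if_true, if_false] <;> fun_prop

@[fun_prop]
lemma measurable_a1 (ys : Bool) : Measurable (M.a1 θ ys) := by
  cases ys <;> unfold a1 <;> simp only [Bool.false_eq_true, if_true, if_false] <;> fun_prop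

lemma abs_a0_le_one (ys : Bool) (z : Fin p → ℝ) : |M.a0 θ ys z| ≤ 1 := by
  cases ys <;> simp [a0, gamma01, abs_of_nonneg, Real.sigmoid_nonneg,
    Real.sigmoid_le_one]

lemma abs_a1_le_one (ys : Bool) (z : Fin p → ℝ) : |M.a1 θ ys z| ≤ 1 := by
  cases ys <;> simp [a1, gamma10, abs_of_nonneg, Real.sigmoid_nonneg, Real.sigmoid_le_one]

@[fun_prop]
lemma measurable_densV (y ys : Bool) : Measurable (M.densV θ y ys) := by
  cases y <;> unfold densV <;>
    simp only [Bool.false_eq_true, if_true, if_false] <;> fun_prop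

@[fun_prop]
lemma measurable_densM (ys : Bool) : Measurable (M.densM θ ys) := by
  cases ys <;> unfold densM muStar <;>
    simp only [Bool.false_eq_true, if_true, if_false] <;> fun_prop

@[fun_prop]
lemma measurable_logV : Measurable fun o => M.logV o θ :=
  measurable_from_prod_countable_right fun y => measurable_from_prod_countable_right fun ys =>
    (M.measurable_densV θ y ys).log

@[fun_prop]
lemma measurable_logM : Measurable fun o => M.logM o θ :=
  measurable_from_prod_countable_right fun _ => measurable_from_prod_countable_right fun ys =>
    (M.measurable_densM θ ys).log

variable {θ} {z : Fin p → ℝ}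

lemma densV_pos (hz : linPred θ z ∈ M.link '' Set.Ioo 0 1) (y ys : Bool) :
    0 < M.densV θ y ys z := by
  have hmu : M.mu θ z ∈ Set.Ioo (0 : ℝ) 1 := Function.invFunOn_mem hz
  have h01 (x : ℝ) : 0 < Real.sigmoid x ∧ 0 < 1 - Real.sigmoid x :=
    ⟨Real.sigmoid_pos x, sub_pos.2 (Real.sigmoid_lt_one x)⟩
  cases y <;> cases ys <;>
    simp [densV, a0, a1, gamma01, gamma10, h01, hmu.1, hmu.2]

lemma densM_eq_add (θ : Param p q) (ys : Bool) (z : Fin p → ℝ) :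
    M.densM θ ys z = M.densV θ true ys z + M.densV θ false ys z := by
  cases ys <;> simp only [densM, densV, muStar, a0, a1, Bool.false_eq_true, if_true, if_false] <;>
    ring

lemma densM_pos (hz : linPred θ z ∈ M.link '' Set.Ioo 0 1) (ys : Bool) : 0 < M.densM θ ys z := by
  rw [densM_eq_add]
  exact add_pos (M.densV_pos hz _ _) (M.densV_pos hz _ _)

lemma sum_densM (θ : Param p q) (z : Fin p → ℝ) : ∑ ys, M.densM θ ys z = 1 := by
  simp [densM]

lemma sum_densV (θ : Param p q) (z : Fin p → ℝ) :
    ∑ c : Bool × Bool, M.densV θ c.1 c.2 z = 1 := by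
  rw [← M.sum_densM θ z, Fintype.sum_prod_type_right]
  simp only [densM_eq_add, Fintype.sum_bool]

variable {M} {D : Measure (Obs p)} [IsProbabilityMeasure D]

lemma Follows.condProb_surrogate (hD : M.Follows θ D) (ys : Bool) :
    D⟦{o : Obs p | o.2.1 = ys} |
        MeasurableSpace.comap (fun o : Obs p => (o.1, o.2.2)) inferInstance⟧
      =ᵐ[D] fun o => if o.1 then M.a1 θ ys o.2.2 else M.a0 θ ys o.2.2 := by
  have hYZ : Measurable fun o : Obs p => (o.1, o.2.2) := by fun_prop
  filter_upwards [condProb_preimage_bool hYZ.comap_le (T := fun o : Obs p => o.2.1)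
    (by fun_prop) hD.surrogate ys] with o ho
  rw [ho]
  cases ys <;> cases o.1 <;> simp [a0, a1]

lemma Follows.condProb (hD : M.Follows θ D) (y ys : Bool) :
    D⟦{o : Obs p | o.1 = y} ∩ {o | o.2.1 = ys} |
        MeasurableSpace.comap (fun o : Obs p => o.2.2) inferInstance⟧
      =ᵐ[D] fun o => M.densV θ y ys o.2.2 := by
  have hYZ : Measurable fun o : Obs p => (o.1, o.2.2) := by fun_prop
  have hle : MeasurableSpace.comap (fun o : Obs p => o.2.2) inferInstance ≤
      MeasurableSpace.comap (fun o : Obs p => (o.1, o.2.2)) inferInstance := by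
    rintro _ ⟨A, hA, rfl⟩
    exact ⟨Prod.snd ⁻¹' A, measurable_snd hA, rfl⟩
  let a : (Fin p → ℝ) → ℝ := fun z => if y then M.a1 θ ys z else M.a0 θ ys z
  have ha : Measurable a := by
    cases y <;> simp only [a, Bool.false_eq_true, if_true, if_false] <;> fun_prop
  have ha_bound (z : Fin p → ℝ) : ‖a z‖ ≤ 1 := by
    cases y
    · simpa [a] using M.abs_a0_le_one θ ys z
    · simpa [a] using M.abs_a1_le_one θ ys z
  have hresponse := condProb_preimage_bool (hle.trans hYZ.comap_le) (T := fun o : Obs p => o.1)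
    (by fun_prop) hD.response y
  have hinter := condProb_inter hle hYZ.comap_le (A := {o : Obs p | o.1 = y})
    (B := {o | o.2.1 = ys}) (f := fun o => a o.2.2)
    ⟨{y} ×ˢ Set.univ, .prod (measurableSet_singleton y) .univ, by ext; simp⟩
    ((by fun_prop : Measurable fun o : Obs p => o.2.1) (measurableSet_singleton ys))
    (ha.comp (comap_measurable _)).stronglyMeasurable
    (Integrable.of_bound (ha.comp (by fun_prop)).aestronglyMeasurable 1
      (ae_of_all _ fun o => ha_bound o.2.2))
    ((hD.condProb_surrogate ys).mono fun o ho (hy : o.1 = y) => by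
      simp only [ho, hy, a])
  filter_upwards [hinter, hresponse] with o ho hyo
  rw [ho, hyo]
  cases y <;> simp [a, densV, mul_comm]

lemma Follows.restrict_eq_map_withDensity (hD : M.Follows θ D) (y ys : Bool) :
    D.restrict ({o | o.1 = y} ∩ {o | o.2.1 = ys}) =
      (D.withDensity fun o => ENNReal.ofReal (M.densV θ y ys o.2.2)).map
        fun o => (y, ys, o.2.2) := by
  have hZ : Measurable fun o : Obs p => o.2.2 := by fun_prop
  have hfibre : Measurable fun z : Fin p → ℝ => (y, ys, z) := by fun_prop
  have hcell : Measurable fun o : Obs p => (y, ys, o.2.2) := hfibre.comp hZ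
  have hA : MeasurableSet ({o : Obs p | o.1 = y} ∩ {o | o.2.1 = ys}) :=
    ((by fun_prop : Measurable fun o : Obs p => o.1) (measurableSet_singleton y)).inter
      ((by fun_prop : Measurable fun o : Obs p => o.2.1) (measurableSet_singleton ys))
  ext S hS
  have hset : S ∩ ({o : Obs p | o.1 = y} ∩ {o | o.2.1 = ys}) =
      (fun o : Obs p => (y, ys, o.2.2)) ⁻¹' S ∩ ({o | o.1 = y} ∩ {o | o.2.1 = ys}) := by
    ext ⟨y', ys', z⟩
    simp only [Set.mem_inter_iff, Set.mem_ofPred_eq, Set.mem_preimage]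
    exact and_congr_left (by rintro ⟨rfl, rfl⟩; rfl)
  rw [Measure.restrict_apply hS, Measure.map_apply hcell hS, withDensity_apply _ (hcell hS), hset]
  exact measure_inter_eq_setLIntegral_condProb hZ.comap_le hA ⟨_, hfibre hS, rfl⟩
    (hD.condProb y ys)

lemma Follows.densV_nonneg (hD : M.Follows θ D) (y ys : Bool) :
    ∀ᵐ o ∂D, 0 ≤ M.densV θ y ys o.2.2 := by
  filter_upwards [condProb_nonneg, hD.condProb y ys] with o ho hdens
  exact ho.trans_eq hdens

lemma Follows.integrable_densV_mul_and_setIntegral_eq (hD : M.Follows θ D) {h : Obs p → ℝ}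
    (hh : Integrable h D) (y ys : Bool) :
    Integrable (fun o => M.densV θ y ys o.2.2 * h (y, ys, o.2.2)) D ∧
      ∫ o in {o | o.1 = y} ∩ {o | o.2.1 = ys}, h o ∂D
        = ∫ o, M.densV θ y ys o.2.2 * h (y, ys, o.2.2) ∂D := by
  have hfibre : Measurable fun o : Obs p => (y, ys, o.2.2) := by fun_prop
  have hdens : Measurable fun o : Obs p => ENNReal.ofReal (M.densV θ y ys o.2.2) := by fun_prop
  have hfin : ∀ᵐ o ∂D, ENNReal.ofReal (M.densV θ y ys o.2.2) < ⊤ :=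
    ae_of_all _ fun _ => ENNReal.ofReal_lt_top
  have hcongr : (fun o => (ENNReal.ofReal (M.densV θ y ys o.2.2)).toReal • h (y, ys, o.2.2))
      =ᵐ[D] fun o => M.densV θ y ys o.2.2 * h (y, ys, o.2.2) := by
    filter_upwards [hD.densV_nonneg y ys] with o ho
    rw [ENNReal.toReal_ofReal ho, smul_eq_mul]
  have hint := hh.restrict (s := {o | o.1 = y} ∩ {o | o.2.1 = ys})
  rw [hD.restrict_eq_map_withDensity] at hint ⊢
  refine ⟨?_, ?_⟩
  · exact ((integrable_withDensity_iff_integrable_smul' hdens hfin).1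
      ((integrable_map_measure hint.1 hfibre.aemeasurable).1 hint)).congr hcongr
  · rw [integral_map hfibre.aemeasurable hint.1,
      integral_withDensity_eq_integral_toReal_smul hdens hfin]
    exact integral_congr_ae hcongr

theorem Follows.integral_eq (hD : M.Follows θ D) {h : Obs p → ℝ} (hh : Integrable h D) :
    ∫ o, h o ∂D =
      ∫ o, ∑ c : Bool × Bool, M.densV θ c.1 c.2 o.2.2 * h (c.1, c.2, o.2.2) ∂D := by
  have hcells : ⋃ c : Bool × Bool, {o : Obs p | o.1 = c.1} ∩ {o | o.2.1 = c.2} = Set.univ :=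
    Set.eq_univ_of_forall fun o => Set.mem_iUnion.2 ⟨(o.1, o.2.1), rfl, rfl⟩
  rw [← setIntegral_univ, ← hcells, integral_iUnion_fintype, integral_finsetSum]
  · exact Finset.sum_congr rfl fun c _ =>
      (hD.integrable_densV_mul_and_setIntegral_eq hh c.1 c.2).2
  · exact fun c _ => (hD.integrable_densV_mul_and_setIntegral_eq hh c.1 c.2).1
  · exact fun c => ((by fun_prop : Measurable fun o : Obs p => o.1)
      (measurableSet_singleton c.1)).inter
        ((by fun_prop : Measurable fun o : Obs p => o.2.1) (measurableSet_singleton c.2))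
  · exact fun c c' hcc => Set.disjoint_left.2 fun o ho ho' =>
      hcc (Prod.ext (ho.1.symm.trans ho'.1) (ho.2.symm.trans ho'.2))
  · exact fun _ => hh.integrableOn

end MisclassModel

section QuadraticForm

lemma exists_pos_mul_norm_sq_le {E : Type*} [NormedAddCommGroup E] [NormedSpace ℝ E]
    [ProperSpace E] {q : E → ℝ} (hq : Continuous q)
    (hhom : ∀ (t : ℝ) (x : E), q (t • x) = t ^ 2 * q x) (hpos : ∀ x, x ≠ 0 → 0 < q x) :
    ∃ c, 0 < c ∧ ∀ x, c * ‖x‖ ^ 2 ≤ q x := by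
  have hzero : q 0 = 0 := by simpa using hhom 0 0
  rcases subsingleton_or_nontrivial E with hE | hE
  · exact ⟨1, one_pos, fun x => by simp [Subsingleton.elim x 0, hzero]⟩
  obtain ⟨u, hu, hmin⟩ := (isCompact_sphere (0 : E) 1).exists_isMinOn
    (NormedSpace.sphere_nonempty.2 zero_le_one) hq.continuousOn
  refine ⟨q u, hpos u (ne_zero_of_mem_unit_sphere ⟨u, hu⟩), fun x => ?_⟩
  rcases eq_or_ne x 0 with rfl | hx
  · simp [hzero]
  · have hunit : ‖x‖⁻¹ • x ∈ Metric.sphere (0 : E) 1 := by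
      simp [norm_smul, inv_mul_cancel₀ (norm_ne_zero_iff.2 hx)]
    calc q u * ‖x‖ ^ 2 ≤ q (‖x‖⁻¹ • x) * ‖x‖ ^ 2 := by gcongr; exact hmin hunit
      _ = q x := by
        rw [hhom]
        field_simp [norm_ne_zero_iff.2 hx]

lemma exists_pos_mul_norm_sq_le_of_posDef {ι : Type*} [Fintype ι] {A : Matrix ι ι ℝ}
    (hA : A.PosDef) :
    ∃ c, 0 < c ∧ ∀ h : EuclideanSpace ℝ ι, c * ‖h‖ ^ 2 ≤ ∑ j, h j * ∑ k, h k * A j k := by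
  refine exists_pos_mul_norm_sq_le (by fun_prop) (fun t x => ?_) fun x hx => ?_
  · simp only [PiLp.smul_apply, smul_eq_mul, Finset.mul_sum]
    exact Finset.sum_congr rfl fun j _ => Finset.sum_congr rfl fun k _ => by ring
  · have hx' : x.ofLp ≠ 0 := fun h => hx (WithLp.ofLp_injective 2 h)
    simpa [dotProduct, Matrix.mulVec, mul_comm] using hA.dotProduct_mulVec_pos hx'

end QuadraticForm

section InformationIdentities

variable {p q : ℕ} {κ : Type*} [DecidableEq κ] {M : MisclassModel p q} {D : Measure (Obs p)}
  {θ₀ : Param p q} {N : Set (Param p q)} {π : Bool × Bool → κ}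
  {ℓ : κ → (Fin p → ℝ) → Param p q → ℝ}

/-- For almost every `z` and all parameters in `N`, `ℓ · z` is the conditional log-density of the
statistic `π (Y, Y*)` given `Z = z`.  The log-densities `log f(y, y*|z)` and `log f(y*|z)` are
the cases where `π` is the identity and the second projection. -/
def IsCondLogDensity (M : MisclassModel p q) (D : Measure (Obs p)) (N : Set (Param p q))
    (π : Bool × Bool → κ) (ℓ : κ → (Fin p → ℝ) → Param p q → ℝ) : Prop :=
  ∀ᵐ o ∂D, ∀ θ ∈ N, ∀ k,
    Real.exp (ℓ k o.2.2 θ) = ∑ c with π c = k, M.densV θ c.1 c.2 o.2.2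

namespace IsCondLogDensity

lemma id_logV
    (hrange : ∀ᵐ o ∂D, ∀ θ ∈ N, MisclassModel.linPred θ o.2.2 ∈ M.link '' Set.Ioo 0 1) :
    IsCondLogDensity M D N id fun c z => M.logV (c.1, c.2, z) := by
  filter_upwards [hrange] with o ho θ hθ c
  simp only [id, Finset.sum_filter, Finset.sum_ite_eq', Finset.mem_univ, if_true]
  exact Real.exp_log (M.densV_pos (ho θ hθ) _ _)

lemma snd_logM
    (hrange : ∀ᵐ o ∂D, ∀ θ ∈ N, MisclassModel.linPred θ o.2.2 ∈ M.link '' Set.Ioo 0 1) :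
    IsCondLogDensity M D N Prod.snd fun ys z => M.logM (true, ys, z) := by
  filter_upwards [hrange] with o ho θ hθ ys
  rw [Finset.sum_filter, Fintype.sum_prod_type]
  simp only [Finset.sum_ite_eq', Finset.mem_univ, if_true, Fintype.sum_bool]
  rw [← M.densM_eq_add]
  exact Real.exp_log (M.densM_pos (ho θ hθ) _)

lemma sum_exp_eq_one [Fintype κ] (hℓ : IsCondLogDensity M D N π ℓ) :
    ∀ᵐ o ∂D, ∀ θ ∈ N, ∑ k, Real.exp (ℓ k o.2.2 θ) = 1 := by
  filter_upwards [hℓ] with o ho θ hθ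
  rw [← M.sum_densV θ o.2.2, ← Finset.sum_fiberwise Finset.univ π]
  exact Finset.sum_congr rfl fun k _ => ho θ hθ k

variable [IsProbabilityMeasure D]

lemma integral_comp_eq [Fintype κ] (hℓ : IsCondLogDensity M D N π ℓ) (hD : M.Follows θ₀ D)
    (hθ₀ : θ₀ ∈ N) {s : κ → (Fin p → ℝ) → ℝ}
    (hs : Integrable (fun o => s (π (o.1, o.2.1)) o.2.2) D) :
    ∫ o, s (π (o.1, o.2.1)) o.2.2 ∂D = ∫ o, ∑ k, Real.exp (ℓ k o.2.2 θ₀) * s k o.2.2 ∂D := by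
  rw [hD.integral_eq hs]
  refine integral_congr_ae ?_
  filter_upwards [hℓ] with o ho
  rw [← Finset.sum_fiberwise Finset.univ π]
  refine Finset.sum_congr rfl fun k _ => ?_
  rw [ho θ₀ hθ₀, Finset.sum_mul]
  exact Finset.sum_congr rfl fun c hc => by rw [← (Finset.mem_filter.1 hc).2]

variable {L : Obs p → Param p q → ℝ} (hℓ : IsCondLogDensity M D N π ℓ) (hD : M.Follows θ₀ D)
  (hN : IsOpen N) (hθ₀ : θ₀ ∈ N) (hπ : Function.Surjective π)
  (hL : ∀ o, L o = ℓ (π (o.1, o.2.1)) o.2.2) (hsm : SmoothLogDensity D L θ₀ N)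

include hπ hL hsm in
omit [DecidableEq κ] [IsProbabilityMeasure D] in
lemma ae_contDiffOn : ∀ᵐ o ∂D, ∀ k, ContDiffOn ℝ 3 (ℓ k o.2.2) N := by
  filter_upwards [hsm.contDiffOn] with o ho k
  obtain ⟨c, rfl⟩ := hπ k
  exact hL (c.1, c.2, o.2.2) ▸ ho c.1 c.2

include hℓ hD hN hθ₀ hπ hL hsm

lemma integral_score_eq_zero [Finite κ] (j : Unit ⊕ Fin p ⊕ Fin q) :
    ∫ o, pderiv j (L o) θ₀ ∂D = 0 := by
  have := Fintype.ofFinite κ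
  have hint := (hsm.score j).integrable one_le_two
  simp only [hL] at hint ⊢
  rw [hℓ.integral_comp_eq hD hθ₀ (s := fun k z => pderiv j (ℓ k z) θ₀) hint]
  refine integral_eq_zero_of_ae ?_
  filter_upwards [hℓ.sum_exp_eq_one, ae_contDiffOn hπ hL hsm] with o hsum hdiff
  exact sum_exp_mul_pderiv_eq_zero hN (fun k => (hdiff k).differentiableOn three_ne_zero)
    hsum hθ₀ j

lemma integral_hessian_eq_neg_fisherInfo [Finite κ] (j k : Unit ⊕ Fin p ⊕ Fin q) :
    ∫ o, pderiv k (pderiv j (L o)) θ₀ ∂D = -fisherInfo D L θ₀ j k := by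
  have := Fintype.ofFinite κ
  have hhess := hsm.hessian j k
  have hprod : Integrable (fun o => pderiv j (L o) θ₀ * pderiv k (L o) θ₀) D :=
    (hsm.score j).integrable_mul (hsm.score k)
  rw [eq_neg_iff_add_eq_zero, fisherInfo, Matrix.of_apply, ← integral_add hhess hprod]
  have hint := hhess.add hprod
  simp only [hL, Pi.add_def] at hint ⊢
  rw [hℓ.integral_comp_eq hD hθ₀ (s := fun c z =>
    pderiv k (pderiv j (ℓ c z)) θ₀ + pderiv j (ℓ c z) θ₀ * pderiv k (ℓ c z) θ₀) hint]
  refine integral_eq_zero_of_ae ?_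
  filter_upwards [hℓ.sum_exp_eq_one, ae_contDiffOn hπ hL hsm] with o hsum hdiff
  exact sum_exp_mul_pderiv_pderiv_add_eq_zero hN
    (fun c => (hdiff c).of_le (by norm_num)) hsum hθ₀ j k

end IsCondLogDensity

namespace RegularityConditions

variable [IsProbabilityMeasure D] {δ : ℝ}

lemma integral_scoreV (hR : RegularityConditions M D δ θ₀ N) (hD : M.Follows θ₀ D)
    (j : Unit ⊕ Fin p ⊕ Fin q) : ∫ o, pderiv j (M.logV o) θ₀ ∂D = 0 :=
  (IsCondLogDensity.id_logV hR.range).integral_score_eq_zero hD hR.isOpen hR.mem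
    Function.surjective_id (fun _ => rfl) hR.smoothV j

lemma integral_scoreM (hR : RegularityConditions M D δ θ₀ N) (hD : M.Follows θ₀ D)
    (j : Unit ⊕ Fin p ⊕ Fin q) : ∫ o, pderiv j (M.logM o) θ₀ ∂D = 0 :=
  (IsCondLogDensity.snd_logM hR.range).integral_score_eq_zero hD hR.isOpen hR.mem
    Prod.snd_surjective (fun _ => rfl) hR.smoothM j

lemma integral_hessianV (hR : RegularityConditions M D δ θ₀ N) (hD : M.Follows θ₀ D)
    (j k : Unit ⊕ Fin p ⊕ Fin q) :
    ∫ o, pderiv k (pderiv j (M.logV o)) θ₀ ∂D = -fisherInfo D M.logV θ₀ j k :=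
  (IsCondLogDensity.id_logV hR.range).integral_hessian_eq_neg_fisherInfo hD hR.isOpen hR.mem
    Function.surjective_id (fun _ => rfl) hR.smoothV j k

lemma integral_hessianM (hR : RegularityConditions M D δ θ₀ N) (hD : M.Follows θ₀ D)
    (j k : Unit ⊕ Fin p ⊕ Fin q) :
    ∫ o, pderiv k (pderiv j (M.logM o)) θ₀ ∂D = -fisherInfo D M.logM θ₀ j k :=
  (IsCondLogDensity.snd_logM hR.range).integral_hessian_eq_neg_fisherInfo hD hR.isOpen hR.mem
    Prod.snd_surjective (fun _ => rfl) hR.smoothM j k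

end RegularityConditions

end InformationIdentities

section IdenticalDistribution

variable {Ω Ω' : Type*} [MeasurableSpace Ω] [MeasurableSpace Ω'] {P : Measure Ω}
  {P' : Measure Ω'}

lemma identDistrib_comp_of_indepFun [IsProbabilityMeasure P] {A B C : Type*}
    [MeasurableSpace A] [MeasurableSpace B] [MeasurableSpace C] {W : Ω → A} {Y : Ω → B}
    {U : Ω' → C} {f : A → B → C} (hW : Measurable W) (hY : AEMeasurable Y P)
    (hind : IndepFun W Y P) (hf : Measurable (Function.uncurry f))
    (hU : ∀ ω, IdentDistrib (fun ω' => f (W ω) (Y ω')) U P P') :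
    IdentDistrib (fun ω => f (W ω) (Y ω)) U P P' := by
  obtain ⟨ω₀⟩ := P.nonempty_of_neZero
  refine ⟨hf.comp_aemeasurable (hW.aemeasurable.prodMk hY), (hU ω₀).aemeasurable_snd, ?_⟩
  have hsection (w : A) : Measurable (f w) := hf.comp measurable_prodMk_left
  have hlaw : P.map (fun ω => f (W ω) (Y ω)) =
      ((P.map W).prod (P.map Y)).map (Function.uncurry f) := by
    rw [← hind.map_prod_eq_prod_map_map hW.aemeasurable hY,
      AEMeasurable.map_map_of_aemeasurable hf.aemeasurable (hW.aemeasurable.prodMk hY)]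
    rfl
  have : SFinite (P.map Y) := inferInstance
  ext s hs
  calc P.map (fun ω => f (W ω) (Y ω)) s
      = ∫⁻ w, P.map Y (f w ⁻¹' s) ∂P.map W := by
        rw [hlaw, Measure.map_apply hf hs, Measure.prod_apply (hf hs)]
        rfl
    _ = ∫⁻ ω, P.map Y (f (W ω) ⁻¹' s) ∂P :=
        lintegral_map (measurable_measure_prodMk_left (hf hs)) hW
    _ = ∫⁻ _, P'.map U s ∂P := lintegral_congr fun ω => by
        rw [← (hU ω).map_eq, ← Measure.map_apply (hsection _) hs,
          AEMeasurable.map_map_of_aemeasurable (hsection _).aemeasurable hY]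
        rfl
    _ = P'.map U s := by rw [lintegral_const, measure_univ, mul_one]

variable {E : Type*} [AddCommMonoid E] [MeasurableSpace E] [MeasurableAdd₂ E]

lemma identDistrib_sum_of_card_eq {ι : Type*} {Y : ι → Ω → E} (hY : iIndepFun Y P)
    (hident : ∀ i j, IdentDistrib (Y i) (Y j) P P) {s t : Finset ι} (hst : s.card = t.card) :
    IdentDistrib (fun ω => ∑ i ∈ s, Y i ω) (fun ω => ∑ i ∈ t, Y i ω) P P := by
  let e : s ≃ t := Finset.equivOfCardEq hst
  have hpi : IdentDistrib (fun ω (i : s) => Y i ω) (fun ω (i : s) => Y (e i) ω) P P :=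
    .pi (fun i => hident i (e i)) (hY.precomp Subtype.val_injective)
      (hY.precomp (Subtype.val_injective.comp e.injective))
  have hsum := hpi.comp (u := fun y : s → E => ∑ i, y i) (by fun_prop)
  convert hsum using 1
  · ext ω
    exact (Finset.sum_coe_sort s fun i => Y i ω).symm
  · ext ω
    rw [← Finset.sum_coe_sort t fun i => Y i ω]
    exact (e.sum_comp fun i : t => Y i ω).symm

lemma identDistrib_sum_of_indepFun [IsProbabilityMeasure P] {Y : ℕ → Ω → E} (hY : iIndepFun Y P)
    (hident : ∀ i j, IdentDistrib (Y i) (Y j) P P) {m n : ℕ} {W : Ω → Finset ℕ}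
    (hW : Measurable W) (hsub : ∀ ω, W ω ⊆ Finset.range n) (hcard : ∀ ω, (W ω).card = m)
    (hind : IndepFun W (fun ω (i : Fin n) => Y i ω) P) :
    IdentDistrib (fun ω => ∑ i ∈ W ω, Y i ω) (fun ω => ∑ i ∈ Finset.range m, Y i ω) P P := by
  let f : Finset ℕ → (Fin n → E) → E := fun w y => ∑ i : Fin n, if (i : ℕ) ∈ w then y i else 0
  have hf : Measurable (Function.uncurry f) :=
    Finset.measurable_fun_sum _ fun i _ =>
      Measurable.ite ((measurable_finset_mem (i : ℕ)).comp measurable_fst).setOf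
        (by fun_prop) measurable_const
  have hf_sum {w : Finset ℕ} (hw : w ⊆ Finset.range n) (ω : Ω) :
      f w (fun i => Y i ω) = ∑ i ∈ w, Y i ω := by
    rw [← Finset.inter_eq_right.2 hw, ← Finset.filter_mem_eq_inter, Finset.sum_filter,
      Finset.sum_range]
    exact Finset.sum_congr rfl fun i _ => by simp
  have hrange (ω : Ω) : IdentDistrib (fun ω' => f (W ω) fun i => Y i ω')
      (fun ω' => ∑ i ∈ Finset.range m, Y i ω') P P := by
    simp only [hf_sum (hsub ω)]
    exact identDistrib_sum_of_card_eq hY hident (by rw [hcard, Finset.card_range])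
  simpa only [hf_sum (hsub _)] using identDistrib_comp_of_indepFun hW
    (Y := fun ω (i : Fin n) => Y i ω)
    (aemeasurable_pi_lambda _ fun i => (hident i i).aemeasurable_fst) hind hf hrange

end IdenticalDistribution

section ConvergenceInMeasure

variable {Ω : Type*} [MeasurableSpace Ω] {P : Measure Ω}

lemma tendstoInMeasure_of_identDistrib {Ω' ι : Type*} [MeasurableSpace Ω'] {P' : Measure Ω'}
    {l : Filter ι} {f : ι → Ω → ℝ} {g : ι → Ω' → ℝ} {c : ℝ}
    (h : ∀ i, IdentDistrib (f i) (g i) P P') (hg : TendstoInMeasure P' g l fun _ => c) :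
    TendstoInMeasure P f l fun _ => c := fun ε hε =>
  (hg ε hε).congr fun i => ((h i).measure_mem_eq (s := {x | ε ≤ edist x c})
    (measurableSet_le measurable_const (measurable_id.edist measurable_const))).symm

lemma tendstoInMeasure_add {E ι : Type*} [SeminormedAddCommGroup E] {l : Filter ι}
    {f f' : ι → Ω → E} {g g' : Ω → E} (hf : TendstoInMeasure P f l g)
    (hf' : TendstoInMeasure P f' l g') :
    TendstoInMeasure P (fun i ω => f i ω + f' i ω) l fun ω => g ω + g' ω := by
  rw [tendstoInMeasure_iff_norm] at *
  intro ε hε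
  refine tendsto_of_tendsto_of_tendsto_of_le_of_le tendsto_const_nhds
    (by simpa using (hf (ε / 2) (by positivity)).add (hf' (ε / 2) (by positivity)))
    (fun _ => zero_le) fun i => (measure_mono fun ω hω => ?_).trans (measure_union_le _ _)
  by_contra! hsmall
  simp only [Set.mem_union, Set.mem_ofPred_eq, not_or, not_le] at hsmall hω
  rw [add_sub_add_comm] at hω
  linarith [norm_add_le (f i ω - g ω) (f' i ω - g' ω)]

lemma tendstoInMeasure_finsetSum {E ι κ : Type*} [SeminormedAddCommGroup E] {l : Filter ι}
    {f : κ → ι → Ω → E} {g : κ → Ω → E} (s : Finset κ)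
    (hf : ∀ k ∈ s, TendstoInMeasure P (f k) l (g k)) :
    TendstoInMeasure P (fun i ω => ∑ k ∈ s, f k i ω) l fun ω => ∑ k ∈ s, g k ω := by
  classical
  induction s using Finset.induction_on with
  | empty =>
    intro ε hε
    simp [hε.ne', tendsto_const_nhds]
  | insert k s hk ih =>
    simp only [Finset.sum_insert hk]
    exact tendstoInMeasure_add (hf k (Finset.mem_insert_self k s))
      (ih fun k' hk' => hf k' (Finset.mem_insert_of_mem hk'))

lemma tendstoInMeasure_norm_sub {E ι : Type*} [SeminormedAddCommGroup E] {l : Filter ι}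
    {f : ι → Ω → E} {g : Ω → E} (hf : TendstoInMeasure P f l g) :
    TendstoInMeasure P (fun i ω => ‖f i ω - g ω‖) l fun _ => 0 := by
  simpa [tendstoInMeasure_iff_norm] using hf

lemma eventually_measure_lt_le_of_tendstoInMeasure {ι : Type*} {l : Filter ι} {f : ι → Ω → ℝ}
    {a b : ℝ} (hf : TendstoInMeasure P f l fun _ => a) (hab : a < b) {ε : ℝ} (hε : 0 < ε) :
    ∀ᶠ i in l, P {ω | b < f i ω} ≤ ENNReal.ofReal ε := by
  have hdev := tendstoInMeasure_iff_norm.1 hf (b - a) (sub_pos.2 hab)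
  filter_upwards [hdev.eventually_le_const (ENNReal.ofReal_pos.2 hε)] with i hi
  refine (measure_mono fun ω (hω : b < f i ω) => ?_).trans hi
  exact (sub_le_sub_right hω.le a).trans (Real.le_norm_self _)

end ConvergenceInMeasure

lemma tendsto_comp_div_of_tendsto_div {u : ℕ → ℝ} {a κ : ℝ}
    (hu : Tendsto (fun m => u m / m) atTop (𝓝 a)) {m : ℕ → ℕ}
    (hm : Tendsto (fun n => (m n : ℝ) / n) atTop (𝓝 κ)) :
    Tendsto (fun n => u (m n) / n) atTop (𝓝 (κ * a)) := by
  have herr (ε : ℝ) (hε : 0 < ε) : ∃ C, ∀ k : ℕ, |u k - k * a| ≤ ε * k + C := by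
    have hev : ∀ᶠ k : ℕ in atTop, |u k - k * a| - ε * k ≤ 0 := by
      filter_upwards [(tendsto_order.1 (tendsto_iff_dist_tendsto_zero.1 hu)).2 ε hε,
        eventually_gt_atTop 0] with k hk hk₀
      have hk₀' : (0 : ℝ) < k := by exact_mod_cast hk₀
      rw [Real.dist_eq, div_sub' hk₀'.ne', abs_div, abs_of_pos hk₀', div_lt_iff₀ hk₀'] at hk
      linarith
    obtain ⟨C, hC⟩ := (isBoundedUnder_of_eventually_le hev).bddAbove_range
    exact ⟨C, fun k => by linarith [hC ⟨k, rfl⟩]⟩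
  refine tendsto_iff_norm_sub_tendsto_zero.2 (tendsto_order.2
    ⟨fun b hb => Eventually.of_forall fun n => hb.trans_le (norm_nonneg _), fun ε hε => ?_⟩)
  set η := ε / (|κ| + 1)
  obtain ⟨C, hC⟩ := herr η (by positivity)
  have hbound : Tendsto (fun n : ℕ => η * ((m n : ℝ) / n) + C / n + |(m n : ℝ) / n - κ| * |a|)
      atTop (𝓝 (η * κ)) := by
    simpa using ((hm.const_mul η).add (tendsto_const_div_atTop_nhds_zero_nat C)).add
      ((hm.sub_const κ).abs.mul_const |a|)
  have hηκ : η * κ < ε := by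
    rw [div_mul_eq_mul_div, div_lt_iff₀ (by positivity)]
    nlinarith [le_abs_self κ]
  filter_upwards [hbound.eventually_lt_const hηκ, eventually_gt_atTop 0] with n hn hn₀
  have hn₀' : (0 : ℝ) < n := by exact_mod_cast hn₀
  calc ‖u (m n) / n - κ * a‖
      = |(u (m n) - m n * a) / n + (m n / n - κ) * a| := by
        rw [Real.norm_eq_abs]
        congr 1
        ring
    _ ≤ |u (m n) - m n * a| / n + |m n / n - κ| * |a| := by
        rw [← abs_mul, ← abs_of_pos hn₀', ← abs_div, abs_of_pos hn₀']
        exact abs_add_le _ _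
    _ ≤ (η * m n + C) / n + |m n / n - κ| * |a| := by gcongr; exact hC _
    _ = η * (m n / n) + C / n + |m n / n - κ| * |a| := by ring
    _ < ε := hn

section BoundedInProbability

variable {Ω : Type*} [MeasurableSpace Ω] {P : Measure Ω} {U U' : ℕ → Ω → ℝ} {r : ℕ → ℝ}

lemma IsBigOInProb.add (hU : IsBigOInProb P U r) (hU' : IsBigOInProb P U' r) :
    IsBigOInProb P (fun n ω => U n ω + U' n ω) r := by
  intro ε hε
  obtain ⟨K, hK⟩ := hU (ε / 2) (by positivity)
  obtain ⟨K', hK'⟩ := hU' (ε / 2) (by positivity)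
  refine ⟨K + K', ?_⟩
  filter_upwards [hK, hK'] with n hn hn'
  calc P {ω | (K + K') * r n < |U n ω + U' n ω|}
      ≤ P ({ω | K * r n < |U n ω|} ∪ {ω | K' * r n < |U' n ω|}) := measure_mono fun ω hω => by
        by_contra! hsmall
        simp only [Set.mem_union, Set.mem_ofPred_eq, not_or, not_lt] at hsmall hω
        linarith [abs_add_le (U n ω) (U' n ω)]
    _ ≤ ENNReal.ofReal (ε / 2) + ENNReal.ofReal (ε / 2) :=
        (measure_union_le _ _).trans (add_le_add hn hn')
    _ = ENNReal.ofReal ε := by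
        rw [← ENNReal.ofReal_add (by positivity) (by positivity), add_halves]

lemma IsBigOInProb.finsetSum {ι : Type*} {U : ι → ℕ → Ω → ℝ} (s : Finset ι)
    (hU : ∀ j ∈ s, IsBigOInProb P (U j) r) :
    IsBigOInProb P (fun n ω => ∑ j ∈ s, U j n ω) r := by
  classical
  induction s using Finset.induction_on with
  | empty => exact fun ε _ => ⟨0, by simp⟩
  | insert j s hj ih =>
    simp only [Finset.sum_insert hj]
    exact (hU j (Finset.mem_insert_self j s)).add
      (ih fun k hk => hU k (Finset.mem_insert_of_mem hk))

lemma IsBigOInProb.abs (hU : IsBigOInProb P U r) : IsBigOInProb P (fun n ω => |U n ω|) r := by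
  simpa only [IsBigOInProb, abs_abs] using hU

lemma IsBigOInProb.of_identDistrib {Ω' : Type*} [MeasurableSpace Ω'] {P' : Measure Ω'}
    {W : ℕ → Ω' → ℝ} (hW : IsBigOInProb P' W r) (h : ∀ n, IdentDistrib (U n) (W n) P P') :
    IsBigOInProb P U r := fun ε hε =>
  (hW ε hε).imp fun K hK => hK.mono fun n hn => ((h n).measure_mem_eq (s := {x | K * r n < |x|})
    (measurableSet_lt measurable_const measurable_abs)).trans_le hn

lemma IsBigOInProb.of_variance_le [IsFiniteMeasure P] (hU : ∀ n, MemLp (U n) 2 P)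
    (hmean : ∀ n, ∫ ω, U n ω ∂P = 0) {C : ℝ} (hvar : ∀ n, Var[U n; P] ≤ C * r n ^ 2)
    (hr : ∀ᶠ n in atTop, 0 < r n) : IsBigOInProb P U r := by
  intro ε hε
  refine ⟨√((|C| + 1) / ε), hr.mono fun n hn => ?_⟩
  calc P {ω | √((|C| + 1) / ε) * r n < |U n ω|}
      ≤ P {ω | √((|C| + 1) / ε) * r n ≤ |U n ω - ∫ ω', U n ω' ∂P|} := by
        simp only [hmean n, sub_zero]
        exact measure_mono fun ω => le_of_lt (a := _ * r n)
    _ ≤ ENNReal.ofReal (Var[U n; P] / (√((|C| + 1) / ε) * r n) ^ 2) :=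
        meas_ge_le_variance_div_sq (hU n) (by positivity)
    _ ≤ ENNReal.ofReal ε := by
        refine ENNReal.ofReal_le_ofReal ?_
        rw [mul_pow, Real.sq_sqrt (by positivity), div_le_iff₀ (by positivity)]
        calc Var[U n; P] ≤ (|C| + 1) * r n ^ 2 :=
              (hvar n).trans (by gcongr; linarith [le_abs_self C])
          _ = ε * ((|C| + 1) / ε * r n ^ 2) := by field_simp

end BoundedInProbability

namespace ValidationDesign

variable {p : ℕ} {Ω : Type*} [MeasurableSpace Ω] {P : Measure Ω} {D : Measure (Obs p)}
  {X : ℕ → Ω → Obs p} {nv : ℕ → ℕ} {V : ℕ → Ω → Finset ℕ} {h : Obs p → ℝ}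

lemma ae_forall_obs (hV : ValidationDesign P D X nv V) {R : Obs p → Prop} (hR : ∀ᵐ o ∂D, R o) :
    ∀ᵐ ω ∂P, ∀ i, R (X i ω) :=
  ae_all_iff.2 fun i =>
    ae_of_ae_map (hV.law i).aemeasurable (by rwa [(hV.law i).map_eq])

lemma identDistrib_obs (hV : ValidationDesign P D X nv V) (hh : AEMeasurable h D) (i : ℕ) :
    IdentDistrib (fun ω => h (X i ω)) h P D :=
  ((hV.law i).identDistrib .id).comp_of_aemeasurable (u := h) (by rwa [(hV.law i).map_eq])

lemma iIndepFun_obs (hV : ValidationDesign P D X nv V) (hh : AEMeasurable h D) :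
    iIndepFun (fun i ω => h (X i ω)) P :=
  hV.indep.comp₀ (fun _ => h) (fun i => (hV.law i).aemeasurable)
    fun i => by rwa [(hV.law i).map_eq]

lemma indepFun_sel_obs (hV : ValidationDesign P D X nv V) (hh : AEMeasurable h D) (n : ℕ) :
    IndepFun (V n) (fun ω (i : Fin n) => h (X i ω)) P := by
  have hX : Measurable fun ω (i : Fin n) => X i ω :=
    measurable_pi_lambda _ fun i => hV.measurable_obs i
  refine (hV.indep_sel n).comp₀ (φ := id) (ψ := fun x i => h (x i))
    (hV.measurable_sel n).aemeasurable hX.aemeasurable aemeasurable_id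
    (aemeasurable_pi_lambda _ fun i => ?_)
  refine AEMeasurable.comp_aemeasurable ?_ (measurable_pi_apply i).aemeasurable
  rw [Measure.map_map (measurable_pi_apply i) hX]
  exact (hV.law i).map_eq ▸ hh

lemma identDistrib_sum [IsProbabilityMeasure P] (hV : ValidationDesign P D X nv V)
    (hh : AEMeasurable h D) (n : ℕ) :
    IdentDistrib (fun ω => ∑ i ∈ V n ω, h (X i ω))
      (fun ω => ∑ i ∈ Finset.range (nv n), h (X i ω)) P P :=
  identDistrib_sum_of_indepFun (hV.iIndepFun_obs hh)
    (fun i j => (hV.identDistrib_obs hh i).trans (hV.identDistrib_obs hh j).symm)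
    (hV.measurable_sel n) (hV.subset n) (hV.card n) (hV.indepFun_sel_obs hh n)

lemma measurable_sum (hV : ValidationDesign P D X nv V) (hh : Measurable h) (n : ℕ) :
    Measurable fun ω => ∑ i ∈ V n ω, h (X i ω) := by
  have hsum (ω : Ω) : ∑ i ∈ V n ω, h (X i ω) =
      ∑ i ∈ Finset.range n, if i ∈ V n ω then h (X i ω) else 0 := by
    rw [← Finset.sum_filter, Finset.filter_mem_eq_inter, Finset.inter_eq_right.2 (hV.subset n ω)]
  simp only [hsum]
  exact Finset.measurable_fun_sum _ fun i _ => Measurable.ite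
    ((measurable_finset_mem i).comp (hV.measurable_sel n)).setOf
    (hh.comp (hV.measurable_obs i)) measurable_const

lemma card_le [IsProbabilityMeasure P] (hV : ValidationDesign P D X nv V) (n : ℕ) : nv n ≤ n := by
  obtain ⟨ω⟩ := P.nonempty_of_neZero
  simpa [hV.card] using Finset.card_le_card (hV.subset n ω)

lemma compl (hV : ValidationDesign P D X nv V) :
    ValidationDesign P D X (fun n => n - nv n) fun n ω => Finset.range n \ V n ω where
  measurable_obs := hV.measurable_obs
  law := hV.law
  indep := hV.indep
  measurable_sel n := (measurable_of_countable fun v => Finset.range n \ v).comp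
    (hV.measurable_sel n)
  subset _ _ := Finset.sdiff_subset
  card n ω := by rw [Finset.card_sdiff_of_subset (hV.subset n ω), Finset.card_range, hV.card]
  indep_sel n := (hV.indep_sel n).comp (measurable_of_countable fun v => Finset.range n \ v)
    measurable_id

lemma tendsto_card_compl_div [IsProbabilityMeasure P] (hV : ValidationDesign P D X nv V) {δ : ℝ}
    (hnv : Tendsto (fun n => (nv n : ℝ) / n) atTop (𝓝 δ)) :
    Tendsto (fun n => ((n - nv n : ℕ) : ℝ) / n) atTop (𝓝 (1 - δ)) := by
  refine (hnv.const_sub 1).congr' ?_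
  filter_upwards [eventually_ne_atTop 0] with n hn
  rw [Nat.cast_sub (hV.card_le n), sub_div, div_self (Nat.cast_ne_zero.2 hn)]

lemma tendstoInMeasure_sum_div [IsProbabilityMeasure P] (hV : ValidationDesign P D X nv V) {κ : ℝ}
    (hκ : Tendsto (fun n => (nv n : ℝ) / n) atTop (𝓝 κ)) (hh : Integrable h D) :
    TendstoInMeasure P (fun n ω => (∑ i ∈ V n ω, h (X i ω)) / n) atTop
      fun _ => κ * ∫ o, h o ∂D := by
  have hident := hV.identDistrib_obs hh.aemeasurable
  have hlln : ∀ᵐ ω ∂P, Tendsto (fun n : ℕ => (∑ i ∈ Finset.range n, h (X i ω)) / n) atTop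
      (𝓝 (∫ o, h o ∂D)) := by
    rw [← (hident 0).integral_eq]
    exact strong_law_ae_real _ ((hident 0).integrable_iff.2 hh)
      (fun i j hij => (hV.iIndepFun_obs hh.aemeasurable).indepFun hij)
      fun i => (hident i).trans (hident 0).symm
  refine tendstoInMeasure_of_identDistrib
    (fun n => (hV.identDistrib_sum hh.aemeasurable n).div_const (n : ℝ))
    (tendstoInMeasure_of_tendsto_ae (fun n => ?_)
      (hlln.mono fun ω hω => tendsto_comp_div_of_tendsto_div hω hκ))
  exact ((hV.identDistrib_sum hh.aemeasurable n).aemeasurable_snd.div_const _).aestronglyMeasurable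

lemma isBigOInProb_sum [IsProbabilityMeasure P] (hV : ValidationDesign P D X nv V)
    (hh : MemLp h 2 D) (hmean : ∫ o, h o ∂D = 0) :
    IsBigOInProb P (fun n ω => ∑ i ∈ V n ω, h (X i ω)) fun n => √n := by
  have hident := hV.identDistrib_obs hh.aemeasurable
  have hmem (i : ℕ) : MemLp (fun ω => h (X i ω)) 2 P := (hident i).memLp_iff.2 hh
  refine IsBigOInProb.of_identDistrib ?_ (hV.identDistrib_sum hh.aemeasurable)
  refine IsBigOInProb.of_variance_le (C := Var[h; D]) (fun n => memLp_finsetSum _ fun i _ => hmem i)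
    (fun n => ?_) (fun n => ?_) (eventually_gt_atTop 0 |>.mono fun n hn => by positivity)
  · rw [integral_finsetSum _ fun i _ => (hmem i).integrable one_le_two]
    exact Finset.sum_eq_zero fun i _ => (hident i).integral_eq.trans hmean
  · rw [← Finset.sum_fn, IndepFun.variance_sum (fun i _ => hmem i)
      fun i _ j _ hij => (hV.iIndepFun_obs hh.aemeasurable).indepFun hij,
      Finset.sum_congr rfl fun i _ => (hident i).variance_eq, Finset.sum_const, Finset.card_range,
      nsmul_eq_mul, Real.sq_sqrt (Nat.cast_nonneg n), mul_comm]
    gcongr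
    · exact variance_nonneg _ _
    · exact hV.card_le n

end ValidationDesign

section Penalty

lemma abs_sub_le_of_lipschitz_deriv_deriv {f : ℝ → ℝ} {u L ξ₀ ξ r : ℝ}
    (hf : DifferentiableOn ℝ f (Set.Ioi u)) (hf' : DifferentiableOn ℝ (deriv f) (Set.Ioi u))
    (hlip : ∀ ξ₁ > u, ∀ ξ₂ > u, |deriv (deriv f) ξ₁ - deriv (deriv f) ξ₂| ≤ L * |ξ₁ - ξ₂|)
    (hL : 0 ≤ L) (hr : |ξ - ξ₀| ≤ r) (hu : u < ξ₀ - r) :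
    |f ξ - f ξ₀| ≤ |deriv f ξ₀| * r + (|deriv (deriv f) ξ₀| + L * r) * r ^ 2 := by
  have hr₀ : 0 ≤ r := (abs_nonneg _).trans hr
  let s := Metric.closedBall ξ₀ r
  have hs_gt {x : ℝ} (hx : x ∈ s) : u < x := by
    have hdist : |x - ξ₀| ≤ r := hx
    linarith [neg_abs_le (x - ξ₀)]
  have hξ₀ : ξ₀ ∈ s := Metric.mem_closedBall_self hr₀
  have hmvt {F : ℝ → ℝ} (hF : DifferentiableOn ℝ F (Set.Ioi u)) {K : ℝ}
      (hK : ∀ x ∈ s, |deriv F x| ≤ K) {x : ℝ} (hx : x ∈ s) : |F x - F ξ₀| ≤ K * r :=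
    ((convex_closedBall ξ₀ r).norm_image_sub_le_of_norm_deriv_le
      (fun y hy => hF.differentiableAt (Ioi_mem_nhds (hs_gt hy))) hK hξ₀ hx).trans
      (mul_le_mul_of_nonneg_left hx ((abs_nonneg _).trans (hK ξ₀ hξ₀)))
  have hderiv₂ : ∀ x ∈ s, |deriv (deriv f) x| ≤ |deriv (deriv f) ξ₀| + L * r := fun x hx => by
    have hlipx : |deriv (deriv f) x - deriv (deriv f) ξ₀| ≤ L * r :=
      (hlip x (hs_gt hx) ξ₀ (hs_gt hξ₀)).trans (mul_le_mul_of_nonneg_left hx hL)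
    linarith [abs_sub_abs_le_abs_sub (deriv (deriv f) x) (deriv (deriv f) ξ₀)]
  have hderiv : ∀ x ∈ s, |deriv f x| ≤ |deriv f ξ₀| + (|deriv (deriv f) ξ₀| + L * r) * r :=
    fun x hx => by
      linarith [hmvt hf' hderiv₂ hx, abs_sub_abs_le_abs_sub (deriv f x) (deriv f ξ₀)]
  refine (hmvt hf hderiv hr).trans_eq ?_
  ring

variable {p q : ℕ} {ρ : ℝ → ℝ → ℝ} {lam : ℕ → ℝ} {θ₀ : Param p q}

lemma aSeq_nonneg (n : ℕ) : 0 ≤ aSeq ρ lam θ₀ n := Real.iSup_nonneg fun _ => abs_nonneg _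

lemma bSeq_nonneg (n : ℕ) : 0 ≤ bSeq ρ lam θ₀ n := Real.iSup_nonneg fun _ => abs_nonneg _

lemma abs_deriv_le_aSeq (n : ℕ) {j : Fin p} (hj : θ₀.beta j ≠ 0) :
    |deriv (ρ (lam n)) (|θ₀.beta j|)| ≤ aSeq ρ lam θ₀ n :=
  le_ciSup (f := fun i : {i : Fin p // θ₀.beta i ≠ 0} => |deriv (ρ (lam n)) (|θ₀.beta i|)|)
    (Set.finite_range _).bddAbove ⟨j, hj⟩

lemma abs_deriv_deriv_le_bSeq (n : ℕ) {j : Fin p} (hj : θ₀.beta j ≠ 0) :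
    |deriv (deriv (ρ (lam n))) (|θ₀.beta j|)| ≤ bSeq ρ lam θ₀ n :=
  le_ciSup (f := fun i : {i : Fin p // θ₀.beta i ≠ 0} => |deriv (deriv (ρ (lam n))) (|θ₀.beta i|)|)
    (Set.finite_range _).bddAbove ⟨j, hj⟩

lemma Param.exists_pos_two_mul_le_abs_beta (θ : Param p q) :
    ∃ s, 0 < s ∧ ∀ j, θ.beta j ≠ 0 → 2 * s ≤ |θ.beta j| := by
  have hsmall (j : Fin p) : ∀ᶠ s in 𝓝[>] (0 : ℝ), θ.beta j ≠ 0 → 2 * s ≤ |θ.beta j| := by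
    by_cases hj : θ.beta j = 0
    · simp [hj]
    · have hβ : 0 < |θ.beta j| / 2 := by positivity
      filter_upwards [nhdsWithin_le_nhds (gt_mem_nhds hβ)] with s hs _
      linarith
  obtain ⟨s, hs, hs₀⟩ := ((eventually_all.2 hsmall).and self_mem_nhdsWithin).exists
  exact ⟨s, hs₀, hs⟩

lemma Param.abs_abs_beta_add_sub_le_norm (θ h : Param p q) (j : Fin p) :
    |(|(θ + h).beta j| - |θ.beta j|)| ≤ ‖h‖ :=
  (abs_abs_sub_abs_le _ _).trans (by
    simpa [Param.beta] using PiLp.norm_apply_le h (Sum.inr (Sum.inl j)))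

/- Only the coefficients with `θ₀.beta j ≠ 0` can lower the penalty, since `ρ` vanishes at the
others; those stay in the region where the penalty is smooth. -/
lemma IsPenalty.exists_eventually_sum_sub_sum_le (hρ : IsPenalty ρ) (hlam₀ : ∀ n, 0 ≤ lam n)
    (hsmooth : PenaltySmooth ρ lam) (hlam : Tendsto lam atTop (𝓝 0)) (θ₀ : Param p q) :
    ∃ L s : ℝ, 0 < s ∧ ∀ᶠ n in atTop, ∀ h : Param p q, ‖h‖ ≤ s →
      ∑ j, ρ (lam n) |θ₀.beta j| - ∑ j, ρ (lam n) |(θ₀ + h).beta j|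
        ≤ p * (aSeq ρ lam θ₀ n * ‖h‖ + (bSeq ρ lam θ₀ n + L * ‖h‖) * ‖h‖ ^ 2) := by
  obtain ⟨C, L, -, hCL⟩ := hsmooth
  obtain ⟨s, hs, hsβ⟩ := θ₀.exists_pos_two_mul_le_abs_beta
  refine ⟨|L|, s, hs, ?_⟩
  have hClam : Tendsto (fun n => C * lam n) atTop (𝓝 0) := by simpa using hlam.const_mul C
  filter_upwards [hClam.eventually_lt_const hs] with n hn h hh
  have hterm (j : Fin p) : ρ (lam n) |θ₀.beta j| - ρ (lam n) |(θ₀ + h).beta j|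
      ≤ aSeq ρ lam θ₀ n * ‖h‖ + (bSeq ρ lam θ₀ n + |L| * ‖h‖) * ‖h‖ ^ 2 := by
    by_cases hj : θ₀.beta j = 0
    · have hnonneg := hρ.nonneg _ (hlam₀ n) _ (abs_nonneg ((θ₀ + h).beta j))
      rw [hj, abs_zero, hρ.zero _ (hlam₀ n), zero_sub]
      have := aSeq_nonneg (ρ := ρ) (lam := lam) (θ₀ := θ₀) n
      have := bSeq_nonneg (ρ := ρ) (lam := lam) (θ₀ := θ₀) n
      exact (neg_nonpos.2 hnonneg).trans (by positivity)
    · obtain ⟨hdiff, hdiff', hlip⟩ := hCL n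
      calc ρ (lam n) |θ₀.beta j| - ρ (lam n) |(θ₀ + h).beta j|
          ≤ |ρ (lam n) (|(θ₀ + h).beta j|) - ρ (lam n) (|θ₀.beta j|)| := by
            rw [abs_sub_comm]
            exact le_abs_self _
        _ ≤ |deriv (ρ (lam n)) (|θ₀.beta j|)| * ‖h‖
              + (|deriv (deriv (ρ (lam n))) (|θ₀.beta j|)| + |L| * ‖h‖) * ‖h‖ ^ 2 :=
            abs_sub_le_of_lipschitz_deriv_deriv hdiff hdiff'
              (fun ξ₁ h₁ ξ₂ h₂ => (hlip ξ₁ h₁ ξ₂ h₂).trans (by gcongr; exact le_abs_self L))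
              (abs_nonneg L) (θ₀.abs_abs_beta_add_sub_le_norm h j) (by linarith [hsβ j hj])
        _ ≤ _ := by
            gcongr
            · exact abs_deriv_le_aSeq n hj
            · exact abs_deriv_deriv_le_bSeq n hj
  rw [← Finset.sum_sub_distrib]
  refine (Finset.sum_le_card_nsmul _ _ _ fun j _ => hterm j).trans_eq ?_
  rw [Finset.card_univ, Fintype.card_fin, nsmul_eq_mul]

end Penalty

section Likelihood

variable {p q : ℕ} {M : MisclassModel p q} {N : Set (Param p q)} {θ₀ h : Param p q} {n : ℕ}
  {v : Finset ℕ} {x : ℕ → Obs p}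

/-- `F` is three times continuously differentiable on `N`, with third partial derivatives bounded
by `b`. -/
structure HasThirdDerivBound (N : Set (Param p q)) (b : ℝ) (F : Param p q → ℝ) : Prop where
  contDiffOn : ContDiffOn ℝ 3 F N
  abs_pderiv_le : ∀ θ ∈ N, ∀ j k l, |pderiv l (pderiv k (pderiv j F)) θ| ≤ b

lemma sum_sub_sum_le_of_hasThirdDerivBound {ι : Type*} (hN : IsOpen N)
    (hseg : ∀ t ∈ Set.Icc (0 : ℝ) 1, θ₀ + t • h ∈ N) {F : ι → Param p q → ℝ} {b : ι → ℝ}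
    (hF : ∀ i, HasThirdDerivBound N (b i) (F i)) (s : Finset ι) :
    ∑ i ∈ s, F i (θ₀ + h) - ∑ i ∈ s, F i θ₀ ≤
      ∑ j, h j * ∑ i ∈ s, pderiv j (F i) θ₀
        + (∑ j, h j * ∑ k, h k * ∑ i ∈ s, pderiv k (pderiv j (F i)) θ₀) / 2
        + Fintype.card (Unit ⊕ Fin p ⊕ Fin q) ^ 3 * (∑ i ∈ s, b i) * ‖h‖ ^ 3 := by
  have hterm (i : ι) : F i (θ₀ + h) - F i θ₀ ≤ ∑ j, h j * pderiv j (F i) θ₀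
      + (∑ j, h j * ∑ k, h k * pderiv k (pderiv j (F i)) θ₀) / 2
      + Fintype.card (Unit ⊕ Fin p ⊕ Fin q) ^ 3 * b i * ‖h‖ ^ 3 := by
    linarith [le_of_abs_le (abs_sub_taylor_two_pderiv_le hN (hF i).contDiffOn hseg
      (hF i).abs_pderiv_le)]
  rw [← Finset.sum_sub_distrib]
  refine (Finset.sum_le_sum fun i _ => hterm i).trans_eq ?_
  simp only [Finset.sum_add_distrib, ← Finset.sum_div, Finset.mul_sum, Finset.sum_mul]
  rw [Finset.sum_comm, Finset.sum_comm (s := s)]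
  congr 3
  exact Finset.sum_congr rfl fun j _ => Finset.sum_comm

/-- The contribution of subject `i` to the observed-data log-likelihood when the validation sample
is `v`. -/
noncomputable def obsLog (M : MisclassModel p q) (v : Finset ℕ) (x : ℕ → Obs p) (i : ℕ) :
    Param p q → ℝ :=
  if i ∈ v then M.logV (x i) else M.logM (x i)

lemma sum_obsLog (hv : v ⊆ Finset.range n) (T : (Param p q → ℝ) → ℝ) :
    ∑ i ∈ Finset.range n, T (obsLog M v x i) =
      ∑ i ∈ v, T (M.logV (x i)) + ∑ i ∈ Finset.range n \ v, T (M.logM (x i)) := by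
  rw [← Finset.sum_sdiff hv, add_comm]
  congr 1
  · exact Finset.sum_congr rfl fun i hi => by rw [obsLog, if_pos hi]
  · exact Finset.sum_congr rfl fun i hi => by rw [obsLog, if_neg (Finset.mem_sdiff.1 hi).2]

/-- The score of the observed-data log-likelihood. -/
noncomputable def scoreSum (M : MisclassModel p q) (n : ℕ) (v : Finset ℕ) (x : ℕ → Obs p)
    (θ : Param p q) (j : Unit ⊕ Fin p ⊕ Fin q) : ℝ :=
  ∑ i ∈ Finset.range n, pderiv j (obsLog M v x i) θ

/-- The matrix of second partial derivatives of the observed-data log-likelihood. -/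
noncomputable def hessSum (M : MisclassModel p q) (n : ℕ) (v : Finset ℕ) (x : ℕ → Obs p)
    (θ : Param p q) (j k : Unit ⊕ Fin p ⊕ Fin q) : ℝ :=
  ∑ i ∈ Finset.range n, pderiv k (pderiv j (obsLog M v x i)) θ

lemma scoreSum_eq (hv : v ⊆ Finset.range n) (j : Unit ⊕ Fin p ⊕ Fin q) :
    scoreSum M n v x θ₀ j = ∑ i ∈ v, pderiv j (M.logV (x i)) θ₀
      + ∑ i ∈ Finset.range n \ v, pderiv j (M.logM (x i)) θ₀ :=
  sum_obsLog hv (pderiv j · θ₀)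

lemma hessSum_eq (hv : v ⊆ Finset.range n) (j k : Unit ⊕ Fin p ⊕ Fin q) :
    hessSum M n v x θ₀ j k = ∑ i ∈ v, pderiv k (pderiv j (M.logV (x i))) θ₀
      + ∑ i ∈ Finset.range n \ v, pderiv k (pderiv j (M.logM (x i))) θ₀ :=
  sum_obsLog hv fun F => pderiv k (pderiv j F) θ₀

/-- A sample on which the observed-data log-likelihood admits a quadratic expansion at `θ₀`: the
score is at most `T √n`, the Hessian is within `η n` of `-n A`, and the third derivatives are
bounded by an envelope `B` with empirical mean at most `β`. -/
structure IsTypicalSample (M : MisclassModel p q) (N : Set (Param p q)) (θ₀ : Param p q)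
    (A : Matrix (Unit ⊕ Fin p ⊕ Fin q) (Unit ⊕ Fin p ⊕ Fin q) ℝ) (B : Obs p → ℝ) (T η β : ℝ)
    (n : ℕ) (v : Finset ℕ) (x : ℕ → Obs p) : Prop where
  third : ∀ i, HasThirdDerivBound N (B (x i)) (obsLog M v x i)
  score : ∑ j, |scoreSum M n v x θ₀ j| ≤ T * √n
  hess : ∑ j, ∑ k, |hessSum M n v x θ₀ j k / n + A j k| ≤ η
  envelope : (∑ i ∈ Finset.range n, B (x i)) / n ≤ β

lemma quadForm_le_of_sum_abs_le {ι : Type*} [Fintype ι] {A H : Matrix ι ι ℝ} {c η : ℝ}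
    (hA : ∀ h : EuclideanSpace ℝ ι, c * ‖h‖ ^ 2 ≤ ∑ j, h j * ∑ k, h k * A j k)
    (hH : ∑ j, ∑ k, |H j k + A j k| ≤ η) (h : EuclideanSpace ℝ ι) :
    ∑ j, h j * ∑ k, h k * H j k ≤ (η - c) * ‖h‖ ^ 2 := by
  have hsplit : ∑ j, h j * ∑ k, h k * H j k =
      ∑ j, h j * ∑ k, h k * (H j k + A j k) - ∑ j, h j * ∑ k, h k * A j k := by
    simp only [mul_add, Finset.sum_add_distrib, add_sub_cancel_right]
  have hdev : ∑ j, h j * ∑ k, h k * (H j k + A j k) ≤ ‖h‖ ^ 2 * η :=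
    (le_of_abs_le (abs_sum_mul_sum_mul_le_norm_sq_mul_sum_abs h fun j k => H j k + A j k)).trans
      (by gcongr)
  linarith [hA h]

lemma IsTypicalSample.logLik_sub_le
    {A : Matrix (Unit ⊕ Fin p ⊕ Fin q) (Unit ⊕ Fin p ⊕ Fin q) ℝ} {B : Obs p → ℝ} {T η β : ℝ}
    (hx : IsTypicalSample M N θ₀ A B T η β n v x) (hn : 0 < n) (hv : v ⊆ Finset.range n)
    (hN : IsOpen N) {c : ℝ}
    (hA : ∀ h : Param p q, c * ‖h‖ ^ 2 ≤ ∑ j, h j * ∑ k, h k * A j k)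
    (hseg : ∀ t ∈ Set.Icc (0 : ℝ) 1, θ₀ + t • h ∈ N) :
    logLik M n v x (θ₀ + h) - logLik M n v x θ₀ ≤ ‖h‖ * (T * √n)
      + n * ((η - c) / 2 * ‖h‖ ^ 2 + Fintype.card (Unit ⊕ Fin p ⊕ Fin q) ^ 3 * β * ‖h‖ ^ 3) := by
  have hn' : (0 : ℝ) < n := by exact_mod_cast hn
  have hlogLik (θ : Param p q) :
      logLik M n v x θ = ∑ i ∈ Finset.range n, obsLog M v x i θ := (sum_obsLog hv (· θ)).symm
  have htaylor := sum_sub_sum_le_of_hasThirdDerivBound hN hseg hx.third (Finset.range n)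
  have hscore : ∑ j, h j * scoreSum M n v x θ₀ j ≤ ‖h‖ * (T * √n) :=
    (le_of_abs_le (abs_sum_mul_le_norm_mul_sum_abs h _)).trans (by gcongr; exact hx.score)
  have hhess : ∑ j, h j * ∑ k, h k * hessSum M n v x θ₀ j k ≤ n * ((η - c) * ‖h‖ ^ 2) := by
    have hscaled := mul_le_mul_of_nonneg_left
      (quadForm_le_of_sum_abs_le (H := fun j k => hessSum M n v x θ₀ j k / n) hA hx.hess h) hn'.le
    simp only [mul_div_assoc', ← Finset.sum_div] at hscaled
    rwa [mul_div_cancel_left₀ _ hn'.ne'] at hscaled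
  have hthird : Fintype.card (Unit ⊕ Fin p ⊕ Fin q) ^ 3 * (∑ i ∈ Finset.range n, B (x i)) * ‖h‖ ^ 3
      ≤ Fintype.card (Unit ⊕ Fin p ⊕ Fin q) ^ 3 * (β * n) * ‖h‖ ^ 3 := by
    gcongr
    exact (div_le_iff₀ hn').1 hx.envelope
  rw [hlogLik, hlogLik]
  simp only [scoreSum, hessSum] at hscore hhess
  linarith

/- With `r = K α` the score contributes `ν T α r`, the penalty `ν m α r` and the quadratic term
`- ν c r² / 4`, which wins as soon as `K` exceeds `8 (T + m) / c`. -/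
lemma score_add_hessian_add_penalty_neg {ν w a b c α r T K κ m L : ℝ} (hν : 0 < ν) (hr₀ : 0 < r)
    (hr : r = K * α) (hα : 0 < α) (hT : 0 ≤ T) (hm : 0 ≤ m) (hw : w ≤ ν * α) (ha : a ≤ α)
    (hK : 8 * (T + m) < c * K) (hrem : κ * r + m * (b + L * r) ≤ c / 8) :
    r * (T * w) + ν * (-(c / 4) * r ^ 2 + κ * r ^ 3)
      + ν * (m * (a * r + (b + L * r) * r ^ 2)) < 0 := by
  have hlinear : (T + m) * α < c / 8 * r := by
    rw [hr]
    nlinarith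
  calc r * (T * w) + ν * (-(c / 4) * r ^ 2 + κ * r ^ 3)
        + ν * (m * (a * r + (b + L * r) * r ^ 2))
      ≤ r * (T * (ν * α)) + ν * (-(c / 4) * r ^ 2 + κ * r ^ 3)
        + ν * (m * (α * r + (b + L * r) * r ^ 2)) := by gcongr
    _ = ν * r * ((T + m) * α + (κ * r + m * (b + L * r)) * r - c / 4 * r) := by ring
    _ ≤ ν * r * ((T + m) * α + c / 8 * r - c / 4 * r) := by gcongr
    _ < ν * r * (c / 8 * r + c / 8 * r - c / 4 * r) := by gcongr
    _ = 0 := by ring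

lemma eventually_penLogLik_lt {A : Matrix (Unit ⊕ Fin p ⊕ Fin q) (Unit ⊕ Fin p ⊕ Fin q) ℝ}
    {B : Obs p → ℝ} {ρ : ℝ → ℝ → ℝ} {lam α : ℕ → ℝ} {c T K : ℝ} (β : ℝ) (hN : IsOpen N)
    (hθ₀ : θ₀ ∈ N) (hρ : IsPenalty ρ) (hlam₀ : ∀ n, 0 ≤ lam n) (hsmooth : PenaltySmooth ρ lam)
    (hlam : Tendsto lam atTop (𝓝 0)) (hb : Tendsto (bSeq ρ lam θ₀) atTop (𝓝 0)) (hc : 0 < c)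
    (hA : ∀ h : Param p q, c * ‖h‖ ^ 2 ≤ ∑ j, h j * ∑ k, h k * A j k) (hT : 0 ≤ T) (hK₀ : 0 < K)
    (hK : 8 * (T + p) < c * K) (hα : Tendsto α atTop (𝓝 0))
    (hαn : ∀ n : ℕ, 0 < n → √n ≤ n * α n) (hαa : ∀ n, aSeq ρ lam θ₀ n ≤ α n) :
    ∀ᶠ n in atTop, ∀ v ⊆ Finset.range n, ∀ x, IsTypicalSample M N θ₀ A B T (c / 2) β n v x →
      ∀ h : Param p q, ‖h‖ = K * α n →
        penLogLik M ρ (lam n) n v x (θ₀ + h) < penLogLik M ρ (lam n) n v x θ₀ := by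
  obtain ⟨L, s, hs, hpen⟩ := hρ.exists_eventually_sum_sub_sum_le hlam₀ hsmooth hlam θ₀
  obtain ⟨R, hR, hball⟩ := Metric.isOpen_iff.1 hN θ₀ hθ₀
  have hKα : Tendsto (fun n => K * α n) atTop (𝓝 0) := by simpa using hα.const_mul K
  have hrem : Tendsto (fun n => Fintype.card (Unit ⊕ Fin p ⊕ Fin q) ^ 3 * β * (K * α n)
      + p * (bSeq ρ lam θ₀ n + L * (K * α n))) atTop (𝓝 0) := by
    simpa using (hKα.const_mul _).add ((hb.add (hKα.const_mul L)).const_mul (p : ℝ))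
  filter_upwards [hpen, hKα.eventually_lt_const hs, hKα.eventually_lt_const hR,
    hrem.eventually_le_const (show 0 < c / 8 by positivity), eventually_gt_atTop 0]
    with n hpen hs hR hrem hn v hv x hx h hh
  have hn' : (0 : ℝ) < n := by exact_mod_cast hn
  have hα₀ : 0 < α n := pos_of_mul_pos_right ((Real.sqrt_pos.2 hn').trans_le (hαn n hn)) hn'.le
  have hseg : ∀ t ∈ Set.Icc (0 : ℝ) 1, θ₀ + t • h ∈ N := fun t ht => hball <| by
    rw [mem_ball_iff_norm, add_sub_cancel_left, norm_smul, Real.norm_of_nonneg ht.1]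
    exact (mul_le_of_le_one_left (norm_nonneg h) ht.2).trans_lt (hh.trans_lt hR)
  have hlik := hx.logLik_sub_le hn hv hN hA hseg
  have hpenalty := mul_le_mul_of_nonneg_left (hpen h (hh.trans_lt hs).le) hn'.le
  have hneg := score_add_hessian_add_penalty_neg hn' (hh ▸ mul_pos hK₀ hα₀) hh hα₀ hT p.cast_nonneg
    (hαn n hn) (hαa n) hK (hh ▸ hrem)
  rw [show (c / 2 - c) / 2 = -(c / 4) by ring] at hlik
  rw [penLogLik, penLogLik]
  linarith

end Likelihood

section TypicalSamples

variable {p q : ℕ} {M : MisclassModel p q} {θ₀ : Param p q} {N : Set (Param p q)} {Ω : Type*}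
  [MeasurableSpace Ω] {P : Measure Ω} {D : Measure (Obs p)} {X : ℕ → Ω → Obs p} {nv : ℕ → ℕ}
  {V : ℕ → Ω → Finset ℕ} {δ : ℝ}

/-- The limit `δ I₁*(θ₀) + (1 - δ) I₂*(θ₀)` of the observed information per subject. -/
noncomputable def limitInfo (M : MisclassModel p q) (D : Measure (Obs p)) (δ : ℝ)
    (θ₀ : Param p q) : Matrix (Unit ⊕ Fin p ⊕ Fin q) (Unit ⊕ Fin p ⊕ Fin q) ℝ :=
  δ • fisherInfo D M.logV θ₀ + (1 - δ) • fisherInfo D M.logM θ₀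

lemma SmoothLogDensity.exists_envelope {L : Obs p → Param p q → ℝ}
    (hL : SmoothLogDensity D L θ₀ N) :
    ∃ B : Obs p → ℝ, Integrable B D ∧ ∀ᵐ o ∂D, HasThirdDerivBound N (B o) (L o) := by
  obtain ⟨B, hB, hthird⟩ := hL.third
  refine ⟨B, hB, ?_⟩
  filter_upwards [hthird, hL.contDiffOn] with o hthird hdiff
  exact ⟨hdiff o.1 o.2.1, hthird⟩

lemma HasThirdDerivBound.mono {b b' : ℝ} {F : Param p q → ℝ} (hF : HasThirdDerivBound N b F)
    (hb : b ≤ b') : HasThirdDerivBound N b' F :=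
  ⟨hF.contDiffOn, fun θ hθ j k l => (hF.abs_pderiv_le θ hθ j k l).trans hb⟩

lemma RegularityConditions.exists_envelope (hR : RegularityConditions M D δ θ₀ N) :
    ∃ B : Obs p → ℝ, Integrable B D ∧
      ∀ᵐ o ∂D, HasThirdDerivBound N (B o) (M.logV o) ∧ HasThirdDerivBound N (B o) (M.logM o) := by
  obtain ⟨BV, hBV, hV⟩ := hR.smoothV.exists_envelope
  obtain ⟨BM, hBM, hM⟩ := hR.smoothM.exists_envelope
  refine ⟨fun o => BV o ⊔ BM o, hBV.sup hBM, ?_⟩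
  filter_upwards [hV, hM] with o hV hM
  exact ⟨hV.mono le_sup_left, hM.mono le_sup_right⟩

namespace ValidationDesign

lemma ae_forall_obsLog (hV : ValidationDesign P D X nv V) {B : Obs p → ℝ}
    (hB : ∀ᵐ o ∂D, HasThirdDerivBound N (B o) (M.logV o) ∧ HasThirdDerivBound N (B o) (M.logM o)) :
    ∀ᵐ ω ∂P, ∀ v i, HasThirdDerivBound N (B (X i ω)) (obsLog M v (fun i => X i ω) i) := by
  filter_upwards [hV.ae_forall_obs hB] with ω hω v i
  rw [obsLog]
  split_ifs
  · exact (hω i).1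
  · exact (hω i).2

lemma tendstoInMeasure_sum_add_sum_compl_div [IsProbabilityMeasure P]
    (hV : ValidationDesign P D X nv V)
    (hnv : Tendsto (fun n => (nv n : ℝ) / n) atTop (𝓝 δ)) {f g : Obs p → ℝ}
    (hf : Integrable f D) (hg : Integrable g D) :
    TendstoInMeasure P (fun n ω =>
      (∑ i ∈ V n ω, f (X i ω) + ∑ i ∈ Finset.range n \ V n ω, g (X i ω)) / n) atTop
      fun _ => δ * ∫ o, f o ∂D + (1 - δ) * ∫ o, g o ∂D := by
  simp only [add_div]
  exact tendstoInMeasure_add (hV.tendstoInMeasure_sum_div hnv hf)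
    (hV.compl.tendstoInMeasure_sum_div (hV.tendsto_card_compl_div hnv) hg)

lemma tendstoInMeasure_sum_range_div [IsProbabilityMeasure P]
    (hV : ValidationDesign P D X nv V)
    (hnv : Tendsto (fun n => (nv n : ℝ) / n) atTop (𝓝 δ)) {f : Obs p → ℝ} (hf : Integrable f D) :
    TendstoInMeasure P (fun n ω => (∑ i ∈ Finset.range n, f (X i ω)) / n) atTop
      fun _ => ∫ o, f o ∂D := by
  have hsum := hV.tendstoInMeasure_sum_add_sum_compl_div hnv hf hf
  rw [← add_mul, add_sub_cancel, one_mul] at hsum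
  refine hsum.congr_left fun n => ae_of_all _ fun ω => ?_
  rw [add_comm, Finset.sum_sdiff (hV.subset n ω)]

lemma isBigOInProb_scoreSum [IsProbabilityMeasure P] [IsProbabilityMeasure D]
    (hV : ValidationDesign P D X nv V) (hD : M.Follows θ₀ D)
    (hR : RegularityConditions M D δ θ₀ N) :
    IsBigOInProb P (fun n ω => ∑ j, |scoreSum M n (V n ω) (fun i => X i ω) θ₀ j|)
      fun n => √n := by
  have hscore (j : Unit ⊕ Fin p ⊕ Fin q) :
      IsBigOInProb P (fun n ω => scoreSum M n (V n ω) (fun i => X i ω) θ₀ j) fun n => √n := by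
    have hvalid := hV.isBigOInProb_sum (hR.smoothV.score j) (hR.integral_scoreV hD j)
    have hmain := hV.compl.isBigOInProb_sum (hR.smoothM.score j) (hR.integral_scoreM hD j)
    simpa only [scoreSum_eq (hV.subset _ _)] using hvalid.add hmain
  exact IsBigOInProb.finsetSum _ fun j _ => (hscore j).abs

lemma tendstoInMeasure_hessSum_div [IsProbabilityMeasure P] [IsProbabilityMeasure D]
    (hV : ValidationDesign P D X nv V) (hD : M.Follows θ₀ D)
    (hnv : Tendsto (fun n => (nv n : ℝ) / n) atTop (𝓝 δ)) (hR : RegularityConditions M D δ θ₀ N)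
    (j k : Unit ⊕ Fin p ⊕ Fin q) :
    TendstoInMeasure P (fun n ω => hessSum M n (V n ω) (fun i => X i ω) θ₀ j k / n) atTop
      fun _ => -limitInfo M D δ θ₀ j k := by
  have hsum := hV.tendstoInMeasure_sum_add_sum_compl_div hnv (hR.smoothV.hessian j k)
    (hR.smoothM.hessian j k)
  rw [hR.integral_hessianV hD, hR.integral_hessianM hD, mul_neg, mul_neg, ← neg_add] at hsum
  simp only [hessSum_eq (hV.subset _ _)]
  exact hsum

lemma exists_eventually_measure_not_isTypicalSample_le [IsProbabilityMeasure P]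
    [IsProbabilityMeasure D] (hV : ValidationDesign P D X nv V)
    (hD : M.Follows θ₀ D) (hnv : Tendsto (fun n => (nv n : ℝ) / n) atTop (𝓝 δ))
    (hR : RegularityConditions M D δ θ₀ N) {B : Obs p → ℝ} (hB : Integrable B D)
    (hthird : ∀ᵐ o ∂D,
      HasThirdDerivBound N (B o) (M.logV o) ∧ HasThirdDerivBound N (B o) (M.logM o))
    {η β ε : ℝ} (hη : 0 < η) (hβ : ∫ o, B o ∂D < β) (hε : 0 < ε) :
    ∃ T, 0 ≤ T ∧ ∀ᶠ n in atTop, P {ω | ¬ IsTypicalSample M N θ₀ (limitInfo M D δ θ₀) B T η β n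
      (V n ω) fun i => X i ω} ≤ ENNReal.ofReal ε := by
  have hε' : 0 < ε / 3 := by positivity
  obtain ⟨T, hscore⟩ := hV.isBigOInProb_scoreSum hD hR (ε / 3) hε'
  have hhess := tendstoInMeasure_finsetSum Finset.univ fun j _ =>
    tendstoInMeasure_finsetSum Finset.univ fun k _ =>
      tendstoInMeasure_norm_sub (hV.tendstoInMeasure_hessSum_div hD hnv hR j k)
  simp only [Finset.sum_const_zero, sub_neg_eq_add, Real.norm_eq_abs] at hhess
  refine ⟨|T|, abs_nonneg T, ?_⟩
  filter_upwards [hscore, eventually_measure_lt_le_of_tendstoInMeasure hhess hη hε',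
    eventually_measure_lt_le_of_tendstoInMeasure (hV.tendstoInMeasure_sum_range_div hnv hB) hβ hε']
    with n hscore hhess henv
  rw [show ε = ε / 3 + ε / 3 + ε / 3 by ring, ENNReal.ofReal_add (by positivity) hε'.le,
    ENNReal.ofReal_add hε'.le hε'.le]
  refine le_trans ?_ ((measure_union_le _ _).trans
    (add_le_add ((measure_union_le _ _).trans (add_le_add hscore hhess)) henv))
  refine measure_mono_ae ?_
  filter_upwards [hV.ae_forall_obsLog hthird] with ω hω hatyp
  by_contra hgood
  obtain ⟨⟨hscore, hhess⟩, henv⟩ := (not_or.1 hgood).imp_left not_or.1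
  refine hatyp ⟨hω _, (le_abs_self _).trans ((not_lt.1 hscore).trans ?_), not_lt.1 hhess,
    not_lt.1 henv⟩
  gcongr
  exact le_abs_self T

lemma measurable_penLogLik (hV : ValidationDesign P D X nv V) (ρ : ℝ → ℝ → ℝ) (l : ℝ) (n : ℕ)
    (θ : Param p q) : Measurable fun ω => penLogLik M ρ l n (V n ω) (fun i => X i ω) θ :=
  ((hV.measurable_sum (M.measurable_logV θ) n).add
    (hV.compl.measurable_sum (M.measurable_logM θ) n)).sub_const _

end ValidationDesign

lemma continuousOn_penLogLik {ρ : ℝ → ℝ → ℝ} (hρ : IsPenalty ρ) {l : ℝ} (hl : 0 ≤ l) {n : ℕ}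
    {v : Finset ℕ} (hv : v ⊆ Finset.range n) {x : ℕ → Obs p}
    (hx : ∀ i, ContinuousOn (obsLog M v x i) N) : ContinuousOn (penLogLik M ρ l n v x) N := by
  refine ContinuousOn.sub ?_ (Continuous.continuousOn ?_)
  · refine (continuousOn_finsetSum (Finset.range n) fun i _ => hx i).congr fun θ _ => ?_
    exact (sum_obsLog hv (· θ)).symm
  · refine continuous_const.mul (continuous_finsetSum _ fun j _ => ?_)
    refine (hρ.continuousOn l hl).comp_continuous ?_ fun θ => Set.mem_Ici.2 (abs_nonneg _)
    unfold Param.beta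
    fun_prop

end TypicalSamples

section Rate

variable {a : ℕ → ℝ}

lemma tendsto_rpow_neg_half_add (ha : Tendsto a atTop (𝓝 0)) :
    Tendsto (fun n : ℕ => (n : ℝ) ^ (-(1 / 2) : ℝ) + a n) atTop (𝓝 0) := by
  simpa using ((tendsto_rpow_neg_atTop (y := 1 / 2) (by norm_num)).comp
    (tendsto_natCast_atTop_atTop (R := ℝ))).add ha

lemma sqrt_le_mul_rpow_neg_half_add {n : ℕ} (ha : 0 ≤ a n) :
    √n ≤ n * ((n : ℝ) ^ (-(1 / 2) : ℝ) + a n) := by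
  have hsqrt : √n = (n : ℝ) * (n : ℝ) ^ (-(1 / 2) : ℝ) := by
    rw [Real.sqrt_eq_rpow, ← Real.rpow_one_add' n.cast_nonneg (by norm_num)]
    norm_num
  rw [mul_add, ← hsqrt]
  exact le_add_of_nonneg_right (by positivity)

end Rate

theorem mainTheorem1_general {p q : ℕ} (M : MisclassModel p q) (θ₀ : Param p q)
    {Ω : Type*} [MeasurableSpace Ω] (P : Measure Ω) [IsProbabilityMeasure P]
    (D : Measure (Obs p)) [IsProbabilityMeasure D] (hD : M.Follows θ₀ D)
    (X : ℕ → Ω → Obs p) (nv : ℕ → ℕ) (V : ℕ → Ω → Finset ℕ)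
    (hdesign : ValidationDesign P D X nv V)
    (δ : ℝ) (hnv : Tendsto (fun n => (nv n : ℝ) / n) atTop (𝓝 δ))
    (N : Set (Param p q)) (hreg : RegularityConditions M D δ θ₀ N)
    (ρ : ℝ → ℝ → ℝ) (hρ : IsPenalty ρ) (lam : ℕ → ℝ) (hlam_nonneg : ∀ n, 0 ≤ lam n)
    (hsmooth : PenaltySmooth ρ lam)
    (hlam : Tendsto lam atTop (𝓝 0))
    (ha : Tendsto (aSeq ρ lam θ₀) atTop (𝓝 0))
    (hb : Tendsto (bSeq ρ lam θ₀) atTop (𝓝 0)) :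
    ∃ est : ℕ → Ω → Param p q,
      (∀ n, Measurable (est n)) ∧
      Tendsto (fun n => P {ω | ¬ IsLocalMax
        (penLogLik M ρ (lam n) n (V n ω) (fun i => X i ω)) (est n ω)}) atTop (𝓝 0) ∧
      IsBigOInProb P (fun n ω => ‖est n ω - θ₀‖)
        (fun n => (n : ℝ) ^ (-(1 / 2) : ℝ) + aSeq ρ lam θ₀ n) := by
  obtain ⟨B, hB, hthird⟩ := hreg.exists_envelope
  obtain ⟨R, hR, hball⟩ := Metric.nhds_basis_closedBall.mem_iff.1 (hreg.isOpen.mem_nhds hreg.mem)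
  obtain ⟨c, hc, hA⟩ := exists_pos_mul_norm_sq_le_of_posDef hreg.posDef
  refine exists_measurable_isLocalMax hR
    (fun n θ _ => hdesign.measurable_penLogLik ρ (lam n) n θ) (fun n => ?_)
    (fun n => add_nonneg (by positivity) (aSeq_nonneg n)) (tendsto_rpow_neg_half_add ha)
    fun ε hε => ?_
  · filter_upwards [hdesign.ae_forall_obsLog hthird] with ω hω
    exact (continuousOn_penLogLik hρ (hlam_nonneg n) (hdesign.subset n ω)
      fun i => (hω _ i).contDiffOn.continuousOn).mono hball
  · obtain ⟨T, hT, htypical⟩ := hdesign.exists_eventually_measure_not_isTypicalSample_le hD hnv hreg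
      hB hthird (half_pos hc) (lt_add_one _) hε
    obtain ⟨K, hK⟩ := exists_nat_gt (8 * (T + p) / c)
    refine ⟨K, ?_⟩
    filter_upwards [htypical, eventually_penLogLik_lt _ hreg.isOpen hreg.mem hρ hlam_nonneg hsmooth
      hlam hb hc hA hT (lt_of_le_of_lt (by positivity) hK) ((div_lt_iff₀' hc).1 hK)
      (tendsto_rpow_neg_half_add ha) (fun _ _ => sqrt_le_mul_rpow_neg_half_add (aSeq_nonneg _))
      fun _ => le_add_of_nonneg_left (by positivity)] with n htypical hlt
    exact (measure_mono fun ω => mt (hlt _ (hdesign.subset n ω) _)).trans htypical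

theorem mainTheorem1 {p q : ℕ} (M : MisclassModel p q) (θ₀ : Param p q)
    {Ω : Type*} [MeasurableSpace Ω] (P : Measure Ω) [IsProbabilityMeasure P]
    (D : Measure (Obs p)) [IsProbabilityMeasure D] (hD : M.Follows θ₀ D)
    (X : ℕ → Ω → Obs p) (nv : ℕ → ℕ) (V : ℕ → Ω → Finset ℕ)
    (hdesign : ValidationDesign P D X nv V)
    (δ : ℝ) (hδ : 0 < δ ∧ δ ≤ 1)
    (hnv : Tendsto (fun n => (nv n : ℝ) / n) atTop (𝓝 δ))
    (N : Set (Param p q)) (hreg : RegularityConditions M D δ θ₀ N)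
    (ρ : ℝ → ℝ → ℝ) (hρ : IsPenalty ρ) (lam : ℕ → ℝ) (hlam_nonneg : ∀ n, 0 ≤ lam n)
    (hsmooth : PenaltySmooth ρ lam)
    (hlam : Tendsto lam atTop (𝓝 0))
    (ha : Tendsto (aSeq ρ lam θ₀) atTop (𝓝 0))
    (hb : Tendsto (bSeq ρ lam θ₀) atTop (𝓝 0)) :
    ∃ est : ℕ → Ω → Param p q,
      (∀ n, Measurable (est n)) ∧
      Tendsto (fun n => P {ω | ¬ IsLocalMax
        (penLogLik M ρ (lam n) n (V n ω) (fun i => X i ω)) (est n ω)}) atTop (𝓝 0) ∧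
      IsBigOInProb P (fun n ω => ‖est n ω - θ₀‖)
        (fun n => (n : ℝ) ^ (-(1 / 2) : ℝ) + aSeq ρ lam θ₀ n) :=
  mainTheorem1_general M θ₀ P D hD X nv V hdesign δ hnv N hreg ρ hρ lam hlam_nonneg hsmooth hlam
    ha hb
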